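/- Let $F$ be a field and let $\Lambda$ be a finite-dimensional hereditary $F$-algebra, i.e. every submodule of a projective left $\Lambda$-module is projective. Let $\Lambda\text{-mod}$ be the category of finitely generated left $\Lambda$-modules, write $(-)^*=\operatorname{Hom}_F(-,F)$, let $(-)^\vee=\operatorname{Hom}_\Lambda(-,\Lambda)$, and let $\nu=(-)^{\vee *}$ be the Nakayama functor, so that $\nu\Lambda\cong\Lambda^*$. Let $\tau=\operatorname{Ext}^1_\Lambda(-,\Lambda)^*$ and $\tau^-=\operatorname{Ext}^1_{\Lambda^{\mathrm{op}}}((-)^*,\Lambda)$ be the Auslander–Reiten translations, regarded as endofunctors of $\Lambda\text{-mod}$, and write $\tau^{-r}=(\tau^-)^r$ for $r\ge 0$. The preprojective algebra is $$\Pi=\bigoplus_{r\ge 0}\operatorname{Hom}_\Lambda(\Lambda,\tau^{-r}\Lambda),$$ where the product of $g:\Lambda\to\tau^{-s}\Lambda$ and $f:\Lambda\to\tau^{-r}\Lambda$ is $gf=\tau^{-r}g\circ f$. The postinjective algebra is $$\Pi'=\bigoplus_{r\ge 0}\operatorname{Hom}_\Lambda(\tau^{r}\Lambda^*,\Lambda^*),$$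 where the product of $g:\tau^s\Lambda^*\to\Lambda^*$ and $f:\tau^r\Lambda^*\to\Lambda^*$ is $gf=g\circ\tau^sf$. In both algebras the $r$-th summand is the part of degree $r$. Then $\tau^-$ is left adjoint to $\tau$. Fix any adjunction between them. For finitely generated projective left $\Lambda$-modules $P,Q$ and $r\ge0$ let $\Delta^r_{P,Q}$ be the composite of the isomorphisms $$\operatorname{Hom}_\Lambda(P,\tau^{-r}Q)\to\operatorname{Hom}_\Lambda(\tau^{-r}Q,\nu P)^*\to\operatorname{Hom}_\Lambda(Q,\tau^{r}\nu P)^*\to\operatorname{Hom}_\Lambda(\tau^{r}\nu P,\nu Q)^{**}\to\operatorname{Hom}_\Lambda(\tau^{r}\nu P,\nu Q)$$ given by Serre duality $\operatorname{Hom}_\Lambda(P,M)\cong\operatorname{Hom}_\Lambda(M,\nu P)^*$, the ($r$-fold iterated) adjunction, Serre duality again, and evaluation. Let $\Delta:\Pi\to\Pi'$ be the linear map which in degree $r$ is $\Delta^r_{\Lambda,\Lambda}$, where $\nu\Lambda$ is identified with $\Lambda^*$. Then $\Delta$ is an isomorphism of graded $F$-algebras. Moreover, $\Delta$ is given by the maps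 $\Delta^r_{P,Q}$ on components: for $P,Q$ as above, $f:P\to\tau^{-r}Q$, $a:\Lambda\to P$ and $b:Q\to\Lambda$, $$\Delta\bigl(\tau^{-r}(b)\circ f\circ a\bigr)=\nu(b)\circ\Delta^r_{P,Q}(f)\circ\tau^r(\nu(a)).$$ In particular, if $\Lambda=\bigoplus_i P_i$ is a decomposition of the regular left module and $I_i=\nu P_i$, then $\Delta$ sends $f:P_i\to\tau^{-r}P_j$ to $\Delta^r_{P_i,P_j}(f):\tau^rI_i\to I_j$. -/

import Mathlib

open CategoryTheory
open scoped TensorProduct DirectSum ModuleCat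

universe u v

namespace HereditaryAlgebra

noncomputable section

/-! ### Hereditary rings -/

/-- A ring is (left) hereditary if every submodule of a projective left module is projective. -/
def IsHereditary (A : Type u) [Ring A] : Prop :=
  ∀ (P : Type u) [AddCommGroup P] [Module A P], Module.Projective A P →
    ∀ N : Submodule A P, Module.Projective A N

/-! ### Iterates of an endofunctor and the two graded algebras attached to it -/

section Iterates

variable {C : Type u} [Category.{v} C]

/-- The iterate `L ^ n`, with `L ^ (n + 1) X = L (L ^ n X)`. -/
def iterL (L : C ⥤ C) : ℕ → (C ⥤ C)
  | 0 => 𝟭 C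
  | n + 1 => iterL L n ⋙ L

/-- The iterate `R ^ n`, with `R ^ (n + 1) X = R ^ n (R X)`. -/
def iterR (R : C ⥤ C) : ℕ → (C ⥤ C)
  | 0 => 𝟭 C
  | n + 1 => R ⋙ iterR R n

theorem iterL_comp (L : C ⥤ C) (s r : ℕ) : iterL L s ⋙ iterL L r = iterL L (s + r) := by
  induction r with
  | zero => rfl
  | succ r ih => exact congrArg (fun G => G ⋙ L) ih

theorem iterR_comp (R : C ⥤ C) (s r : ℕ) : iterR R r ⋙ iterR R s = iterR R (s + r) := by
  induction r with
  | zero => rfl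
  | succ r ih => exact congrArg (fun G => R ⋙ G) ih

theorem iterL_obj (L : C ⥤ C) (s r : ℕ) (X : C) :
    (iterL L r).obj ((iterL L s).obj X) = (iterL L (s + r)).obj X :=
  Functor.congr_obj (iterL_comp L s r) X

theorem iterR_obj (R : C ⥤ C) (s r : ℕ) (Y : C) :
    (iterR R s).obj ((iterR R r).obj Y) = (iterR R (s + r)).obj Y :=
  Functor.congr_obj (iterR_comp R s r) Y

/-- The iterate of an adjunction `L ⊣ R`. -/
def iterAdj {L R : C ⥤ C} (adj : L ⊣ R) : ∀ n : ℕ, iterL L n ⊣ iterR R n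
  | 0 => Adjunction.id
  | n + 1 => (iterAdj adj n).comp adj

section GradedPieces

variable (L R : C ⥤ C) (X Y : C)

/-- The degree `r` part `Hom (X, L ^ r X)`. -/
def LPiece (r : ℕ) : Type v := X ⟶ (iterL L r).obj X

/-- The degree `r` part `Hom (R ^ r Y, Y)`. -/
def RPiece (r : ℕ) : Type v := (iterR R r).obj Y ⟶ Y

variable {L R X Y}

/-- The product of `g : X ⟶ L ^ s X` and `f : X ⟶ L ^ r X` is `L ^ r g ∘ f`. -/
def LPiece.mul {s r : ℕ} (g : LPiece L X s) (f : LPiece L X r) : LPiece L X (s + r) :=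
  (show X ⟶ (iterL L r).obj X from f) ≫ (iterL L r).map g ≫ eqToHom (iterL_obj L s r X)

/-- The product of `g : R ^ s Y ⟶ Y` and `f : R ^ r Y ⟶ Y` is `g ∘ R ^ s f`. -/
def RPiece.mul {s r : ℕ} (g : RPiece R Y s) (f : RPiece R Y r) : RPiece R Y (s + r) :=
  eqToHom (iterR_obj R s r Y).symm ≫ (iterR R s).map f ≫ (show (iterR R s).obj Y ⟶ Y from g)

theorem LPiece.mk_eq {i j : ℕ} (h : i = j) (f : X ⟶ (iterL L i).obj X)
    (g : X ⟶ (iterL L j).obj X) (w : f ≫ eqToHom (by rw [h]) = g) :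
    (GradedMonoid.mk i f : GradedMonoid (LPiece L X)) = GradedMonoid.mk j g := by
  subst h; simp at w; rw [w]

theorem RPiece.mk_eq {i j : ℕ} (h : i = j) (f : (iterR R i).obj Y ⟶ Y)
    (g : (iterR R j).obj Y ⟶ Y) (w : eqToHom (by rw [h]) ≫ f = g) :
    (GradedMonoid.mk i f : GradedMonoid (RPiece R Y)) = GradedMonoid.mk j g := by
  subst h; simp at w; rw [w]

theorem LPiece.one_mul {r : ℕ} (f : X ⟶ (iterL L r).obj X) :
    (GradedMonoid.mk (0 + r) (LPiece.mul (s := 0) (𝟙 X) f) : GradedMonoid (LPiece L X)) =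
      GradedMonoid.mk r f := by
  refine LPiece.mk_eq (Nat.zero_add r) _ _ ?_
  have h : (iterL L r).map (𝟙 X) = 𝟙 _ := (iterL L r).map_id X
  change (f ≫ (iterL L r).map (𝟙 X) ≫ eqToHom _) ≫ eqToHom _ = f
  rw [h]
  simp

theorem LPiece.mul_one {r : ℕ} (f : X ⟶ (iterL L r).obj X) :
    (GradedMonoid.mk (r + 0) (LPiece.mul (r := 0) f (𝟙 X)) : GradedMonoid (LPiece L X)) =
      GradedMonoid.mk r f := by
  refine LPiece.mk_eq (Nat.add_zero r) _ _ ?_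
  change (𝟙 X ≫ f ≫ 𝟙 _) ≫ 𝟙 _ = f
  simp

theorem LPiece.mul_assoc {t s r : ℕ} (h : X ⟶ (iterL L t).obj X) (g : X ⟶ (iterL L s).obj X)
    (f : X ⟶ (iterL L r).obj X) :
    (GradedMonoid.mk (t + s + r) (LPiece.mul (LPiece.mul h g) f) : GradedMonoid (LPiece L X)) =
      GradedMonoid.mk (t + (s + r)) (LPiece.mul h (LPiece.mul g f)) := by
  refine LPiece.mk_eq (Nat.add_assoc t s r) _ _ ?_
  have e := Functor.congr_hom (iterL_comp L s r) h
  change (f ≫ (iterL L r).map (g ≫ (iterL L s).map h ≫ eqToHom _) ≫ eqToHom _) ≫ eqToHom _ =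
    (f ≫ (iterL L r).map g ≫ eqToHom _) ≫ (iterL L (s + r)).map h ≫ eqToHom _
  simp only [Functor.comp_map] at e
  simp [e, eqToHom_map]

theorem RPiece.one_mul {r : ℕ} (f : (iterR R r).obj Y ⟶ Y) :
    (GradedMonoid.mk (0 + r) (RPiece.mul (s := 0) (𝟙 Y) f) : GradedMonoid (RPiece R Y)) =
      GradedMonoid.mk r f := by
  refine RPiece.mk_eq (Nat.zero_add r) _ _ ?_
  change eqToHom _ ≫ eqToHom _ ≫ f ≫ 𝟙 Y = f
  rw [Category.comp_id]
  have aux : ∀ {A B : C} (p : A = B) (q : B = A) (k : A ⟶ Y),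
      eqToHom p ≫ eqToHom q ≫ k = k := by
    intro A B p q k; subst p; simp
  exact aux _ _ f

theorem RPiece.mul_one {r : ℕ} (f : (iterR R r).obj Y ⟶ Y) :
    (GradedMonoid.mk (r + 0) (RPiece.mul (r := 0) f (𝟙 Y)) : GradedMonoid (RPiece R Y)) =
      GradedMonoid.mk r f := by
  refine RPiece.mk_eq (Nat.add_zero r) _ _ ?_
  have h : (iterR R r).map (𝟙 Y) = 𝟙 _ := (iterR R r).map_id Y
  change eqToHom _ ≫ eqToHom _ ≫ (iterR R r).map (𝟙 Y) ≫ f = f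
  rw [h]
  simp

theorem RPiece.mul_assoc {t s r : ℕ} (h : (iterR R t).obj Y ⟶ Y) (g : (iterR R s).obj Y ⟶ Y)
    (f : (iterR R r).obj Y ⟶ Y) :
    (GradedMonoid.mk (t + s + r) (RPiece.mul (RPiece.mul h g) f) : GradedMonoid (RPiece R Y)) =
      GradedMonoid.mk (t + (s + r)) (RPiece.mul h (RPiece.mul g f)) := by
  refine RPiece.mk_eq (Nat.add_assoc t s r) _ _ ?_
  have e := Functor.congr_hom (iterR_comp R t s) f
  change eqToHom _ ≫ eqToHom _ ≫ (iterR R (t + s)).map f ≫ eqToHom _ ≫ (iterR R t).map g ≫ h =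
    eqToHom _ ≫ (iterR R t).map (eqToHom _ ≫ (iterR R s).map f ≫ g) ≫ h
  simp only [Functor.comp_map] at e
  simp [e, eqToHom_map]

instance : GradedMonoid.GMul (LPiece L X) := ⟨LPiece.mul⟩

instance : GradedMonoid.GOne (LPiece L X) := ⟨𝟙 X⟩

instance : GradedMonoid.GMonoid (LPiece L X) where
  one_mul a := LPiece.one_mul a.2
  mul_one a := LPiece.mul_one a.2
  mul_assoc a b c := LPiece.mul_assoc a.2 b.2 c.2

instance : GradedMonoid.GMul (RPiece R Y) := ⟨RPiece.mul⟩

instance : GradedMonoid.GOne (RPiece R Y) := ⟨𝟙 Y⟩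

instance : GradedMonoid.GMonoid (RPiece R Y) where
  one_mul a := RPiece.one_mul a.2
  mul_one a := RPiece.mul_one a.2
  mul_assoc a b c := RPiece.mul_assoc a.2 b.2 c.2

end GradedPieces

section Algebras

variable (F : Type*) [Field F] [Preadditive C] [Linear F C]
variable (L R : C ⥤ C) (X Y : C)

instance iterL_additive [L.Additive] : ∀ n, (iterL L n).Additive
  | 0 => inferInstanceAs (𝟭 C).Additive
  | n + 1 => by
    have := iterL_additive n
    exact inferInstanceAs (iterL L n ⋙ L).Additive

instance iterR_additive [R.Additive] : ∀ n, (iterR R n).Additive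
  | 0 => inferInstanceAs (𝟭 C).Additive
  | n + 1 => by
    have := iterR_additive n
    exact inferInstanceAs (R ⋙ iterR R n).Additive

instance iterL_linear [L.Linear F] : ∀ n, (iterL L n).Linear F
  | 0 => inferInstanceAs ((𝟭 C).Linear F)
  | n + 1 => by
    have := iterL_linear n
    exact inferInstanceAs ((iterL L n ⋙ L).Linear F)

instance iterR_linear [R.Linear F] : ∀ n, (iterR R n).Linear F
  | 0 => inferInstanceAs ((𝟭 C).Linear F)
  | n + 1 => by
    have := iterR_linear n
    exact inferInstanceAs ((R ⋙ iterR R n).Linear F)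

instance (r : ℕ) : AddCommGroup (LPiece L X r) :=
  inferInstanceAs (AddCommGroup (X ⟶ (iterL L r).obj X))

instance (r : ℕ) : Module F (LPiece L X r) :=
  inferInstanceAs (Module F (X ⟶ (iterL L r).obj X))

instance (r : ℕ) : AddCommGroup (RPiece R Y r) :=
  inferInstanceAs (AddCommGroup ((iterR R r).obj Y ⟶ Y))

instance (r : ℕ) : Module F (RPiece R Y r) :=
  inferInstanceAs (Module F ((iterR R r).obj Y ⟶ Y))

instance [L.Additive] : DirectSum.GSemiring (LPiece L X) where
  mul_zero {i j} a := by
    change (0 : X ⟶ _) ≫ _ ≫ _ = 0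
    exact Limits.zero_comp
  zero_mul {i j} b := by
    change (show X ⟶ (iterL L j).obj X from b) ≫ (iterL L j).map 0 ≫ _ = 0
    rw [Functor.map_zero, Limits.zero_comp, Limits.comp_zero]
  mul_add {i j} a b c := Preadditive.add_comp _ _ _ _ _ _
  add_mul {i j} a b c := by
    change (show X ⟶ (iterL L j).obj X from c) ≫
      (iterL L j).map ((show X ⟶ (iterL L i).obj X from a) +
        (show X ⟶ (iterL L i).obj X from b)) ≫ _ = _
    rw [Functor.map_add, Preadditive.add_comp, Preadditive.comp_add]
    rfl
  natCast n := n • (𝟙 X : X ⟶ X)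
  natCast_zero := zero_nsmul _
  natCast_succ n := succ_nsmul _ n

instance [R.Additive] : DirectSum.GSemiring (RPiece R Y) where
  mul_zero {i j} a := by
    change _ ≫ (iterR R i).map 0 ≫ (show (iterR R i).obj Y ⟶ Y from a) = 0
    rw [Functor.map_zero, Limits.zero_comp, Limits.comp_zero]
  zero_mul {i j} b := by
    change _ ≫ _ ≫ (0 : _ ⟶ Y) = 0
    rw [Limits.comp_zero, Limits.comp_zero]
  mul_add {i j} a b c := by
    change _ ≫ (iterR R i).map ((show (iterR R j).obj Y ⟶ Y from b) +
      (show (iterR R j).obj Y ⟶ Y from c)) ≫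
      (show (iterR R i).obj Y ⟶ Y from a) = _
    rw [Functor.map_add, Preadditive.add_comp, Preadditive.comp_add]
    rfl
  add_mul {i j} a b c := by
    change _ ≫ _ ≫ ((show (iterR R i).obj Y ⟶ Y from a) +
      (show (iterR R i).obj Y ⟶ Y from b)) = _
    rw [Preadditive.comp_add, Preadditive.comp_add]
    rfl
  natCast n := n • (𝟙 Y : Y ⟶ Y)
  natCast_zero := zero_nsmul _
  natCast_succ n := succ_nsmul _ n

theorem LPiece.smul_mul [L.Additive] [L.Linear F] {s r : ℕ} (c : F) (g : LPiece L X s)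
    (f : LPiece L X r) : LPiece.mul (c • g) f = c • LPiece.mul g f := by
  change (show X ⟶ (iterL L r).obj X from f) ≫
    (iterL L r).map (c • (show X ⟶ (iterL L s).obj X from g)) ≫ _ = _
  rw [Functor.map_smul, Linear.smul_comp, Linear.comp_smul]
  rfl

theorem LPiece.mul_smul [L.Additive] {s r : ℕ} (c : F) (g : LPiece L X s)
    (f : LPiece L X r) : LPiece.mul g (c • f) = c • LPiece.mul g f :=
  Linear.smul_comp _ _ _ _ _ _

theorem RPiece.smul_mul [R.Additive] {s r : ℕ} (c : F) (g : RPiece R Y s)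
    (f : RPiece R Y r) : RPiece.mul (c • g) f = c • RPiece.mul g f := by
  change _ ≫ _ ≫ (c • (show (iterR R s).obj Y ⟶ Y from g)) = _
  rw [Linear.comp_smul, Linear.comp_smul]
  rfl

theorem RPiece.mul_smul [R.Additive] [R.Linear F] {s r : ℕ} (c : F) (g : RPiece R Y s)
    (f : RPiece R Y r) : RPiece.mul g (c • f) = c • RPiece.mul g f := by
  change _ ≫ (iterR R s).map (c • (show (iterR R r).obj Y ⟶ Y from f)) ≫
    (show (iterR R s).obj Y ⟶ Y from g) = _
  rw [Functor.map_smul, Linear.smul_comp, Linear.comp_smul]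
  rfl

instance [L.Additive] [L.Linear F] : Algebra F (⨁ r, LPiece L X r) :=
  Algebra.ofModule
    (fun c x y => by
      induction x using DirectSum.induction_on with
      | zero => simp
      | add a b ha hb => rw [smul_add, add_mul, ha, hb, add_mul, smul_add]
      | of i a =>
        induction y using DirectSum.induction_on with
        | zero => simp
        | add a b ha hb => rw [mul_add, ha, hb, mul_add, smul_add]
        | of j b =>
          rw [← DirectSum.of_smul, DirectSum.of_mul_of, DirectSum.of_mul_of, ← DirectSum.of_smul]
          exact congrArg _ (LPiece.smul_mul F L X c a b))
    (fun c x y => by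
      induction x using DirectSum.induction_on with
      | zero => simp
      | add a b ha hb => rw [add_mul, ha, hb, add_mul, smul_add]
      | of i a =>
        induction y using DirectSum.induction_on with
        | zero => simp
        | add a b ha hb => rw [smul_add, mul_add, ha, hb, mul_add, smul_add]
        | of j b =>
          rw [← DirectSum.of_smul, DirectSum.of_mul_of, DirectSum.of_mul_of, ← DirectSum.of_smul]
          exact congrArg _ (LPiece.mul_smul F L X c a b))

instance [R.Additive] [R.Linear F] : Algebra F (⨁ r, RPiece R Y r) :=
  Algebra.ofModule
    (fun c x y => by
      induction x using DirectSum.induction_on with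
      | zero => simp
      | add a b ha hb => rw [smul_add, add_mul, ha, hb, add_mul, smul_add]
      | of i a =>
        induction y using DirectSum.induction_on with
        | zero => simp
        | add a b ha hb => rw [mul_add, ha, hb, mul_add, smul_add]
        | of j b =>
          rw [← DirectSum.of_smul, DirectSum.of_mul_of, DirectSum.of_mul_of, ← DirectSum.of_smul]
          exact congrArg _ (RPiece.smul_mul F R Y c a b))
    (fun c x y => by
      induction x using DirectSum.induction_on with
      | zero => simp
      | add a b ha hb => rw [add_mul, ha, hb, add_mul, smul_add]
      | of i a =>
        induction y using DirectSum.induction_on with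
        | zero => simp
        | add a b ha hb => rw [smul_add, mul_add, ha, hb, mul_add, smul_add]
        | of j b =>
          rw [← DirectSum.of_smul, DirectSum.of_mul_of, DirectSum.of_mul_of, ← DirectSum.of_smul]
          exact congrArg _ (RPiece.mul_smul F R Y c a b))

/-- The bijection `Hom (L ^ n X, Y) ≃ Hom (X, R ^ n Y)` given by an adjunction `L ⊣ R`. -/
def iterHomEquiv {L R : C ⥤ C} (adj : L ⊣ R) [R.Additive] [R.Linear F] (n : ℕ) (X Y : C) :
    ((iterL L n).obj X ⟶ Y) ≃ₗ[F] (X ⟶ (iterR R n).obj Y) where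
  toFun := (iterAdj adj n).homEquiv X Y
  invFun := ((iterAdj adj n).homEquiv X Y).symm
  left_inv := ((iterAdj adj n).homEquiv X Y).left_inv
  right_inv := ((iterAdj adj n).homEquiv X Y).right_inv
  map_add' f g := by simp [Adjunction.homEquiv_unit]
  map_smul' c f := by simp [Adjunction.homEquiv_unit]

end Algebras

end Iterates

/-! ### Duals of modules -/

section Duals

variable (F : Type u) [Field F]

/-- The dual `M^*` of a left `A`-module, as a right `A`-module: `(ξ a) x = ξ (a x)`. -/
def DualL (M : Type u) [AddCommGroup M] [Module F M] : Type u := M →ₗ[F] F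

/-- The dual `X^*` of a right `A`-module, as a left `A`-module: `(a ξ) x = ξ (x a)`. -/
def DualR (X : Type u) [AddCommGroup X] [Module F X] : Type u := X →ₗ[F] F

section

variable (M : Type u) [AddCommGroup M] [Module F M]

instance : AddCommGroup (DualL F M) := inferInstanceAs (AddCommGroup (M →ₗ[F] F))
instance : Module F (DualL F M) := inferInstanceAs (Module F (M →ₗ[F] F))
instance : FunLike (DualL F M) M F := inferInstanceAs (FunLike (M →ₗ[F] F) M F)
instance : AddCommGroup (DualR F M) := inferInstanceAs (AddCommGroup (M →ₗ[F] F))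
instance : Module F (DualR F M) := inferInstanceAs (Module F (M →ₗ[F] F))
instance : FunLike (DualR F M) M F := inferInstanceAs (FunLike (M →ₗ[F] F) M F)
instance : LinearMapClass (DualL F M) F M F :=
  inferInstanceAs (LinearMapClass (M →ₗ[F] F) F M F)
instance : LinearMapClass (DualR F M) F M F :=
  inferInstanceAs (LinearMapClass (M →ₗ[F] F) F M F)
instance [Module.Finite F M] : Module.Finite F (DualL F M) :=
  inferInstanceAs (Module.Finite F (M →ₗ[F] F))
instance [Module.Finite F M] : Module.Finite F (DualR F M) :=
  inferInstanceAs (Module.Finite F (M →ₗ[F] F))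

@[ext] theorem DualL.ext {M : Type u} [AddCommGroup M] [Module F M] {ξ η : DualL F M}
    (h : ∀ x, ξ x = η x) : ξ = η := LinearMap.ext h

@[ext] theorem DualR.ext {M : Type u} [AddCommGroup M] [Module F M] {ξ η : DualR F M}
    (h : ∀ x, ξ x = η x) : ξ = η := LinearMap.ext h

end

variable {A : Type u} [Ring A] [Algebra F A]

instance (M : Type u) [AddCommGroup M] [Module F M] [Module A M] [IsScalarTower F A M] :
    Module Aᵐᵒᵖ (DualL F M) where
  smul a ξ := LinearMap.comp (show M →ₗ[F] F from ξ) (Algebra.lsmul F F M a.unop)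
  one_smul ξ := DualL.ext F fun x => congrArg ξ (one_smul A x)
  mul_smul a b ξ := DualL.ext F fun x => congrArg ξ (mul_smul b.unop a.unop x)
  smul_zero _ := rfl
  smul_add _ _ _ := rfl
  add_smul a b ξ := DualL.ext F fun x =>
    (congrArg ξ (add_smul a.unop b.unop x)).trans (map_add ξ _ _)
  zero_smul ξ := DualL.ext F fun x => (congrArg ξ (zero_smul A x)).trans (map_zero ξ)

instance (X : Type u) [AddCommGroup X] [Module F X] [Module Aᵐᵒᵖ X] [IsScalarTower F Aᵐᵒᵖ X] :
    Module A (DualR F X) where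
  smul a ξ := LinearMap.comp (show X →ₗ[F] F from ξ)
    (Algebra.lsmul F F X (MulOpposite.op a))
  one_smul ξ := DualR.ext F fun x => congrArg ξ (one_smul Aᵐᵒᵖ x)
  mul_smul a b ξ := DualR.ext F fun x =>
    congrArg ξ (mul_smul (MulOpposite.op b) (MulOpposite.op a) x)
  smul_zero _ := rfl
  smul_add _ _ _ := rfl
  add_smul a b ξ := DualR.ext F fun x =>
    (congrArg ξ (add_smul (MulOpposite.op a) (MulOpposite.op b) x)).trans (map_add ξ _ _)
  zero_smul ξ := DualR.ext F fun x => (congrArg ξ (zero_smul Aᵐᵒᵖ x)).trans (map_zero ξ)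

theorem DualL.smul_apply (M : Type u) [AddCommGroup M] [Module F M] [Module A M]
    [IsScalarTower F A M] (a : A) (ξ : DualL F M) (x : M) :
    (MulOpposite.op a • ξ) x = ξ (a • x) := rfl

theorem DualR.smul_apply (X : Type u) [AddCommGroup X] [Module F X] [Module Aᵐᵒᵖ X]
    [IsScalarTower F Aᵐᵒᵖ X] (a : A) (ξ : DualR F X) (x : X) :
    (a • ξ) x = ξ (MulOpposite.op a • x) := rfl

instance (M : Type u) [AddCommGroup M] [Module F M] [Module A M] [IsScalarTower F A M] :
    IsScalarTower F Aᵐᵒᵖ (DualL F M) :=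
  IsScalarTower.of_algebraMap_smul fun c ξ => DualL.ext F fun x =>
    (congrArg ξ (algebraMap_smul A c x)).trans (map_smul ξ c x)

instance (X : Type u) [AddCommGroup X] [Module F X] [Module Aᵐᵒᵖ X] [IsScalarTower F Aᵐᵒᵖ X] :
    IsScalarTower F A (DualR F X) :=
  IsScalarTower.of_algebraMap_smul fun c ξ => DualR.ext F fun x =>
    (congrArg ξ (algebraMap_smul Aᵐᵒᵖ c x)).trans (map_smul ξ c x)

/-- The transpose `f^* : N^* → M^*` of a map of left modules. -/
def DualL.map {M N : Type u} [AddCommGroup M] [Module F M] [Module A M] [IsScalarTower F A M]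
    [AddCommGroup N] [Module F N] [Module A N] [IsScalarTower F A N] (f : M →ₗ[A] N) :
    DualL F N →ₗ[Aᵐᵒᵖ] DualL F M where
  toFun ξ := LinearMap.comp (show N →ₗ[F] F from ξ) (f.restrictScalars F)
  map_add' _ _ := rfl
  map_smul' a ξ := DualL.ext F fun x => congrArg ξ (f.map_smul a.unop x).symm

/-- The transpose `f^* : Y^* → X^*` of a map of right modules. -/
def DualR.map {X Y : Type u} [AddCommGroup X] [Module F X] [Module Aᵐᵒᵖ X]
    [IsScalarTower F Aᵐᵒᵖ X] [AddCommGroup Y] [Module F Y] [Module Aᵐᵒᵖ Y]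
    [IsScalarTower F Aᵐᵒᵖ Y] (f : X →ₗ[Aᵐᵒᵖ] Y) :
    DualR F Y →ₗ[A] DualR F X where
  toFun ξ := LinearMap.comp (show Y →ₗ[F] F from ξ) (f.restrictScalars F)
  map_add' _ _ := rfl
  map_smul' a ξ := DualR.ext F fun x => congrArg ξ (f.map_smul (MulOpposite.op a) x).symm

end Duals

/-! ### `Ext¹` through the standard resolution -/

section ExtOne

variable (F : Type u) [Field F] (A : Type u) [Ring A] [Algebra F A]

/-- The free cover `A ⊗ M → M`, `a ⊗ m ↦ a m`. -/
def cover (M : Type u) [AddCommGroup M] [Module F M] [Module A M] [IsScalarTower F A M] :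
    A ⊗[F] M →ₗ[A] M :=
  TensorProduct.AlgebraTensorModule.lift
    { toFun := fun a =>
        { toFun := fun m => a • m
          map_add' := smul_add a
          map_smul' := fun c m => smul_comm a c m }
      map_add' := fun a b => LinearMap.ext fun m => add_smul a b m
      map_smul' := fun a b => LinearMap.ext fun m => mul_smul a b m }

/-- The kernel of the free cover `A ⊗ M → M`.  If `A` is hereditary it is projective, and
`0 → Syz M → A ⊗ M → M → 0` is a projective resolution of `M`, functorial in `M`. -/
abbrev Syz (M : Type u) [AddCommGroup M] [Module F M] [Module A M] [IsScalarTower F A M] :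
    Submodule A (A ⊗[F] M) :=
  LinearMap.ker (cover F A M)

variable {A}

/-- The map induced on the kernels of the free covers. -/
def Syz.map {M N : Type u} [AddCommGroup M] [Module F M] [Module A M] [IsScalarTower F A M]
    [AddCommGroup N] [Module F N] [Module A N] [IsScalarTower F A N] (f : M →ₗ[A] N) :
    Syz F A M →ₗ[A] Syz F A N :=
  (TensorProduct.AlgebraTensorModule.lTensor A A (f.restrictScalars F)).restrict (by
    intro x hx
    have h : (cover F A N) ∘ₗ
        TensorProduct.AlgebraTensorModule.lTensor A A (f.restrictScalars F) =
        f ∘ₗ cover F A M := by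
      ext m
      simp [cover]
    have h' := LinearMap.congr_fun h x
    rw [LinearMap.mem_ker] at hx ⊢
    simpa [hx] using h')

/-- Precomposition with a map of `A`-modules, linear over any ring `B` acting on the target. -/
def precomp (B : Type u) [Ring B] {M N W : Type u} [AddCommMonoid M] [Module A M]
    [AddCommMonoid N] [Module A N] [AddCommGroup W] [Module A W] [Module B W]
    [SMulCommClass A B W] (f : M →ₗ[A] N) : (N →ₗ[A] W) →ₗ[B] (M →ₗ[A] W) where
  toFun φ := φ.comp f
  map_add' _ _ := rfl
  map_smul' _ _ := rfl

variable (A) (B : Type u) [Ring B] [Algebra F B]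

/-- `Ext¹_A (M, W)` for a left `A`-module `M` and an `A`-module `W` with a commuting action
of `B`: the cokernel of `Hom_A (A ⊗ M, W) → Hom_A (Syz M, W)`. -/
abbrev ExtOne (M W : Type u) [AddCommGroup M] [Module F M] [Module A M] [IsScalarTower F A M]
    [AddCommGroup W] [Module A W] [Module B W] [SMulCommClass A B W] : Type u :=
  (Syz F A M →ₗ[A] W) ⧸ LinearMap.range (precomp B (W := W) (Syz F A M).subtype)

variable {A}

/-- The contravariant functoriality of `Ext¹_A (-, W)`. -/
def ExtOne.map {M N : Type u} (W : Type u) [AddCommGroup M] [Module F M] [Module A M]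
    [IsScalarTower F A M] [AddCommGroup N] [Module F N] [Module A N] [IsScalarTower F A N]
    [AddCommGroup W] [Module A W] [Module B W] [SMulCommClass A B W] (f : M →ₗ[A] N) :
    ExtOne F A B N W →ₗ[B] ExtOne F A B M W :=
  Submodule.mapQ _ _ (precomp B (Syz.map F f)) (by
    rintro _ ⟨φ, rfl⟩
    exact ⟨φ.comp (TensorProduct.AlgebraTensorModule.lTensor A A (f.restrictScalars F)), rfl⟩)

section MapLemmas

variable {M N K : Type u} [AddCommGroup M] [Module F M] [Module A M] [IsScalarTower F A M]
  [AddCommGroup N] [Module F N] [Module A N] [IsScalarTower F A N]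
  [AddCommGroup K] [Module F K] [Module A K] [IsScalarTower F A K]

theorem Syz.map_coe (f : M →ₗ[A] N) (x : Syz F A M) :
    (Syz.map F f x : A ⊗[F] N) = LinearMap.lTensor A (f.restrictScalars F) (x : A ⊗[F] M) := rfl

theorem Syz.map_id : Syz.map F (LinearMap.id : M →ₗ[A] M) = LinearMap.id :=
  LinearMap.ext fun x => Subtype.ext <|
    LinearMap.congr_fun (LinearMap.lTensor_id A M : LinearMap.lTensor A (.id : M →ₗ[F] M) = _) x.1

theorem Syz.map_comp (g : N →ₗ[A] K) (f : M →ₗ[A] N) :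
    Syz.map F (g.comp f) = (Syz.map F g).comp (Syz.map F f) :=
  LinearMap.ext fun x => Subtype.ext <| LinearMap.congr_fun
    (LinearMap.lTensor_comp A (g.restrictScalars F) (f.restrictScalars F)) x.1

theorem Syz.map_add (f g : M →ₗ[A] N) : Syz.map F (f + g) = Syz.map F f + Syz.map F g :=
  LinearMap.ext fun x => Subtype.ext <| LinearMap.congr_fun
    (LinearMap.lTensor_add A (f.restrictScalars F) (g.restrictScalars F)) x.1

theorem Syz.map_smul (c : F) (f : M →ₗ[A] N) : Syz.map F (c • f) = c • Syz.map F f :=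
  LinearMap.ext fun x => Subtype.ext <| LinearMap.congr_fun
    (LinearMap.lTensor_smul A c (f.restrictScalars F)) x.1

variable (W : Type u) [AddCommGroup W] [Module A W] [Module B W] [SMulCommClass A B W]

theorem ExtOne.map_mk (f : M →ₗ[A] N) (φ : Syz F A N →ₗ[A] W) :
    ExtOne.map F B W f (Submodule.Quotient.mk φ) =
      Submodule.Quotient.mk (φ.comp (Syz.map F f)) := rfl

theorem ExtOne.map_id : ExtOne.map F B W (LinearMap.id : M →ₗ[A] M) = LinearMap.id := by
  refine LinearMap.ext fun x => ?_
  obtain ⟨φ, rfl⟩ := Submodule.Quotient.mk_surjective _ x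
  rw [ExtOne.map_mk, Syz.map_id]
  rfl

theorem ExtOne.map_comp (g : N →ₗ[A] K) (f : M →ₗ[A] N) :
    ExtOne.map F B W (g.comp f) = (ExtOne.map F B W f).comp (ExtOne.map F B W g) := by
  refine LinearMap.ext fun x => ?_
  obtain ⟨φ, rfl⟩ := Submodule.Quotient.mk_surjective _ x
  rw [ExtOne.map_mk, Syz.map_comp]
  rfl

theorem ExtOne.map_add (f g : M →ₗ[A] N) :
    ExtOne.map F B W (f + g) = ExtOne.map F B W f + ExtOne.map F B W g := by
  refine LinearMap.ext fun x => ?_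
  obtain ⟨φ, rfl⟩ := Submodule.Quotient.mk_surjective _ x
  rw [ExtOne.map_mk, Syz.map_add, LinearMap.comp_add]
  rfl

theorem ExtOne.map_smul [Module F W] [IsScalarTower F A W] [IsScalarTower F B W] (c : F)
    (f : M →ₗ[A] N) : ExtOne.map F B W (c • f) = c • ExtOne.map F B W f := by
  refine LinearMap.ext fun x => ?_
  obtain ⟨φ, rfl⟩ := Submodule.Quotient.mk_surjective _ x
  rw [ExtOne.map_mk, Syz.map_smul]
  have h : φ.comp (c • Syz.map F f) = c • φ.comp (Syz.map F f) := by
    refine LinearMap.ext fun y => ?_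
    exact φ.map_smul_of_tower c _
  rw [h]
  rfl

end MapLemmas

end ExtOne

/-! ### Finiteness -/

section Finiteness

variable (F : Type u) [Field F] {A : Type u} [Ring A] [Algebra F A]

theorem finite_hom (M W : Type u) [AddCommGroup M] [Module F M] [Module A M]
    [IsScalarTower F A M] [AddCommGroup W] [Module F W] [Module A W] [IsScalarTower F A W]
    [Module.Finite F M] [Module.Finite F W] : Module.Finite F (M →ₗ[A] W) :=
  Module.Finite.of_injective (LinearMap.restrictScalarsₗ F A M W F)
    (LinearMap.restrictScalars_injective F)

theorem finite_syz [Module.Finite F A] (M : Type u) [AddCommGroup M] [Module F M] [Module A M]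
    [IsScalarTower F A M] [Module.Finite F M] : Module.Finite F (Syz F A M) :=
  Module.Finite.of_injective ((Syz F A M).subtype.restrictScalars F)
    (Submodule.subtype_injective _)

instance [Module.Finite F A] (M : FGModuleCat.{u} A) : Module.Finite F M :=
  Module.Finite.trans A M

end Finiteness

/-! ### The functors -/

section Functors

variable (F : Type u) [Field F] (A : Type u) [Ring A] [Algebra F A] [Module.Finite F A]

instance finite_nu (P : Type u) [AddCommGroup P] [Module F P] [Module A P] [IsScalarTower F A P]
    [Module.Finite F P] : Module.Finite A (DualR F (P →ₗ[A] A)) :=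
  have : Module.Finite F (P →ₗ[A] A) := finite_hom F P A
  Module.Finite.of_restrictScalars_finite F A _

instance finite_tau (M : Type u) [AddCommGroup M] [Module F M] [Module A M] [IsScalarTower F A M]
    [Module.Finite F M] : Module.Finite A (DualR F (ExtOne F A Aᵐᵒᵖ M A)) :=
  have := finite_syz F (A := A) M
  have : Module.Finite F (Syz F A M →ₗ[A] A) := finite_hom F (A := A) (Syz F A M) A
  Module.Finite.of_restrictScalars_finite F A _

instance finite_tauInv (M : Type u) [AddCommGroup M] [Module F M] [Module A M]
    [IsScalarTower F A M] [Module.Finite F M] :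
    Module.Finite A (ExtOne F Aᵐᵒᵖ A (DualL F M) A) :=
  have := finite_syz F (A := Aᵐᵒᵖ) (DualL F M)
  have : Module.Finite F (Syz F Aᵐᵒᵖ (DualL F M) →ₗ[Aᵐᵒᵖ] A) :=
    finite_hom F (A := Aᵐᵒᵖ) (Syz F Aᵐᵒᵖ (DualL F M)) A
  Module.Finite.of_restrictScalars_finite F A _

/-- The Nakayama functor `ν = (-)^{∨*}`, with `P^∨ = Hom_A (P, A)`. -/
def nu : FGModuleCat.{u} A ⥤ FGModuleCat.{u} A where
  obj P := FGModuleCat.of A (DualR F (P →ₗ[A] A))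
  map f := FGModuleCat.ofHom (DualR.map F (precomp Aᵐᵒᵖ f.hom.hom))
  map_id _ := rfl
  map_comp _ _ := rfl

/-- The Auslander-Reiten translation `τ = D Tr` of a hereditary algebra, as an endofunctor of the
category of finitely generated left modules.  For a hereditary algebra the transpose
is `Tr = Ext¹_A (-, A)`, from left to right modules. -/
def tau : FGModuleCat.{u} A ⥤ FGModuleCat.{u} A where
  obj M := FGModuleCat.of A (DualR F (ExtOne F A Aᵐᵒᵖ M A))
  map f := FGModuleCat.ofHom (DualR.map F (ExtOne.map F Aᵐᵒᵖ A f.hom.hom))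
  map_id _ := by
    refine FGModuleCat.hom_ext ?_
    change DualR.map F (ExtOne.map F Aᵐᵒᵖ A LinearMap.id) = LinearMap.id
    rw [ExtOne.map_id]
    rfl
  map_comp f g := by
    refine FGModuleCat.hom_ext ?_
    change DualR.map F (ExtOne.map F Aᵐᵒᵖ A (g.hom.hom.comp f.hom.hom)) = _
    rw [ExtOne.map_comp]
    rfl

/-- The inverse Auslander-Reiten translation `τ⁻ = Tr D` of a hereditary algebra, as an
endofunctor of the category of finitely generated left modules.  Here `Tr = Ext¹ (-, A)` goes from
right modules, that is, modules over the opposite algebra, to left modules. -/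
def tauInv : FGModuleCat.{u} A ⥤ FGModuleCat.{u} A where
  obj M := FGModuleCat.of A (ExtOne F Aᵐᵒᵖ A (DualL F M) A)
  map f := FGModuleCat.ofHom (ExtOne.map F A A (DualL.map F f.hom.hom))
  map_id _ := FGModuleCat.hom_ext (ExtOne.map_id F A A)
  map_comp f g := FGModuleCat.hom_ext
    (ExtOne.map_comp F A A (DualL.map F f.hom.hom) (DualL.map F g.hom.hom))

instance : (tau F A).Additive where
  map_add {_ _ f g} := by
    refine FGModuleCat.hom_ext ?_
    change DualR.map F (ExtOne.map F Aᵐᵒᵖ A (f.hom.hom + g.hom.hom)) = _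
    rw [ExtOne.map_add]
    refine LinearMap.ext fun ξ => DualR.ext F fun x => ?_
    exact map_add ξ _ _

instance : (tau F A).Linear F where
  map_smul {M N} f c := by
    refine FGModuleCat.hom_ext ?_
    change DualR.map F (ExtOne.map F Aᵐᵒᵖ A (c • f.hom.hom)) = _
    rw [ExtOne.map_smul]
    refine LinearMap.ext fun ξ => ?_
    refine Eq.trans ?_ (algebraMap_smul A c (DualR.map F (ExtOne.map F Aᵐᵒᵖ A f.hom.hom) ξ)).symm
    refine DualR.ext F fun x => ?_
    exact map_smul ξ c _

instance : (tauInv F A).Additive where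
  map_add {_ _ f g} := by
    refine FGModuleCat.hom_ext ?_
    have h : DualL.map F (f.hom.hom + g.hom.hom) =
        DualL.map F f.hom.hom + DualL.map F g.hom.hom :=
      LinearMap.ext fun ξ => DualL.ext F fun x => map_add ξ _ _
    change ExtOne.map F A A (DualL.map F (f.hom.hom + g.hom.hom)) = _
    rw [h, ExtOne.map_add]
    rfl

instance : (tauInv F A).Linear F where
  map_smul {M N} f c := by
    refine FGModuleCat.hom_ext ?_
    have h : DualL.map F (c • f.hom.hom) = c • DualL.map F f.hom.hom :=
      LinearMap.ext fun ξ => DualL.ext F fun x => map_smul ξ c _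
    change ExtOne.map F A A (DualL.map F (c • f.hom.hom)) = _
    rw [h, ExtOne.map_smul]
    refine LinearMap.ext fun x => ?_
    exact (algebraMap_smul A c (ExtOne.map F A A (DualL.map F f.hom.hom) x)).symm

end Functors

/-! ### Serre duality -/

section Serre

variable (F : Type u) [Field F] {A : Type u} [Ring A] [Algebra F A] [Module.Finite F A]

instance (M N : FGModuleCat.{u} A) : Module.Finite F (M ⟶ N) := by
  have := finite_hom F (A := A) M N
  let f : (M ⟶ N) →ₗ[F] (M →ₗ[A] N) :=
    { toFun := fun f => f.hom.hom
      map_add' := fun _ _ => rfl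
      map_smul' := fun _ _ => rfl }
  exact Module.Finite.of_injective f fun a b h => FGModuleCat.hom_ext h

variable (P M : FGModuleCat.{u} A)

/-- For `φ ∈ P^∨` and `m ∈ M` the map `P → M`, `p ↦ φ p • m`. -/
def rankOne {P M : FGModuleCat.{u} A} (φ : P →ₗ[A] A) (m : M) : P ⟶ M :=
  FGModuleCat.ofHom ((LinearMap.toSpanSingleton A M m).comp φ)

theorem rankOne_apply {P M : FGModuleCat.{u} A} (φ : P →ₗ[A] A) (m : M) (p : P) :
    (rankOne φ m).hom.hom p = φ p • m := rfl

section RankOne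

variable {P M : FGModuleCat.{u} A}

theorem rankOne_add_left (φ ψ : P →ₗ[A] A) (m : M) :
    rankOne (φ + ψ) m = rankOne φ m + rankOne ψ m :=
  FGModuleCat.hom_ext (LinearMap.ext fun p => add_smul (φ p) (ψ p) m)

theorem rankOne_smul_left (c : F) (φ : P →ₗ[A] A) (m : M) :
    rankOne (c • φ) m = c • rankOne φ m :=
  FGModuleCat.hom_ext (LinearMap.ext fun p => smul_assoc c (φ p) m)

theorem rankOne_add_right (φ : P →ₗ[A] A) (m n : M) :
    rankOne φ (m + n) = rankOne φ m + rankOne φ n :=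
  FGModuleCat.hom_ext (LinearMap.ext fun p => smul_add (φ p) m n)

theorem rankOne_op_smul (a : A) (φ : P →ₗ[A] A) (m : M) :
    rankOne (MulOpposite.op a • φ) m = rankOne φ (a • m) :=
  FGModuleCat.hom_ext (LinearMap.ext fun p => mul_smul (φ p) a m)

end RankOne

/-- The map `Hom (P, M)^* → Hom (M, ν P)` sending `ξ` to `m ↦ (φ ↦ ξ (p ↦ φ p • m))`. -/
def serreAux : Module.Dual F (P ⟶ M) →ₗ[F] (M ⟶ (nu F A).obj P) where
  toFun ξ := FGModuleCat.ofHom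
    { toFun := fun m =>
        ({ toFun := fun φ => ξ (rankOne φ m)
           map_add' := fun φ ψ => (congrArg ξ (rankOne_add_left φ ψ m)).trans (map_add ξ _ _)
           map_smul' := fun c φ =>
            (congrArg ξ (rankOne_smul_left F c φ m)).trans (map_smul ξ c _) } :
          (P →ₗ[A] A) →ₗ[F] F)
      map_add' := fun m n => LinearMap.ext fun φ =>
        (congrArg ξ (rankOne_add_right φ m n)).trans (map_add ξ _ _)
      map_smul' := fun a m => LinearMap.ext fun φ =>
        congrArg ξ (rankOne_op_smul a φ m).symm }
  map_add' _ _ := rfl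
  map_smul' c ξ := by
    refine FGModuleCat.hom_ext (LinearMap.ext fun m => ?_)
    refine Eq.trans ?_ (algebraMap_smul A c (M := DualR F (P →ₗ[A] A)) _).symm
    rfl

theorem serreAux_apply (ξ : Module.Dual F (P ⟶ M)) (m : M) (φ : P →ₗ[A] A) :
    (show DualR F (P →ₗ[A] A) from (serreAux F P M ξ).hom.hom m) φ = ξ (rankOne φ m) := rfl

theorem exists_dual_basis [Module.Projective A P] :
    ∃ (n : ℕ) (c : Fin n → (P →ₗ[A] A)) (b : Fin n → P), ∀ x, ∑ k, c k x • b k = x := by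
  obtain ⟨n, f, g, -, -, h⟩ := Module.Finite.exists_comp_eq_id_of_projective A P
  refine ⟨n, fun k => (LinearMap.proj k).comp g, fun k => f (Pi.single k 1), fun x => ?_⟩
  have h' : f (g x) = x := LinearMap.congr_fun h x
  conv_rhs => rw [← h', ← Finset.univ_sum_single (g x), map_sum]
  refine Finset.sum_congr rfl fun k _ => ?_
  rw [← map_smul]
  congr 1
  ext i
  by_cases hi : i = k
  · subst hi; simp
  · simp [hi]

theorem serreAux_bijective [Module.Projective A P] : Function.Bijective (serreAux F P M) := by
  obtain ⟨n, c, b, hb⟩ := exists_dual_basis P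
  constructor
  · intro ξ η h
    refine LinearMap.ext fun f => ?_
    have hf : f = ∑ k, rankOne (c k) (f.hom.hom (b k)) := by
      refine FGModuleCat.hom_ext (LinearMap.ext fun x => ?_)
      let ev : (P ⟶ M) →+ M :=
        { toFun := fun u => u.hom.hom x
          map_zero' := rfl
          map_add' := fun _ _ => rfl }
      refine Eq.trans ?_ (map_sum ev (fun k => rankOne (c k) (f.hom.hom (b k))) Finset.univ).symm
      conv_lhs => rw [← hb x, map_sum]
      exact Finset.sum_congr rfl fun k _ => map_smul f.hom.hom _ _
    rw [hf, map_sum, map_sum]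
    refine Finset.sum_congr rfl fun k _ => ?_
    rw [← serreAux_apply, ← serreAux_apply, h]
  · intro h
    let hh : M →ₗ[A] DualR F (P →ₗ[A] A) := h.hom.hom
    have hsmul : ∀ (r : F) (m : M), hh (r • m) = r • hh m := fun r m => by
      rw [← algebraMap_smul A r m, map_smul, algebraMap_smul]
    refine ⟨{ toFun := fun f => ∑ k, hh (f.hom.hom (b k)) (c k)
              map_add' := fun f g => ?_
              map_smul' := fun r f => ?_ }, ?_⟩
    · rw [← Finset.sum_add_distrib]
      refine Finset.sum_congr rfl fun k _ => ?_
      change hh (f.hom.hom (b k) + g.hom.hom (b k)) (c k) = _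
      rw [map_add]
      rfl
    · rw [RingHom.id_apply, Finset.smul_sum]
      refine Finset.sum_congr rfl fun k _ => ?_
      change hh (r • f.hom.hom (b k)) (c k) = _
      rw [hsmul]
      rfl
    · refine FGModuleCat.hom_ext (LinearMap.ext fun m => DualR.ext F fun φ => ?_)
      change ∑ k, hh (φ (b k) • m) (c k) = hh m φ
      have hφ : φ = ∑ k, MulOpposite.op (φ (b k)) • c k := by
        refine LinearMap.ext fun x => ?_
        conv_lhs => rw [← hb x, map_sum]
        rw [LinearMap.sum_apply]
        exact Finset.sum_congr rfl fun k _ => map_smul φ _ _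
      conv_rhs => rw [hφ, map_sum]
      refine Finset.sum_congr rfl fun k _ => ?_
      rw [map_smul]
      rfl

/-- Serre duality `Hom (P, M) ≅ Hom (M, ν P)^*` for `P` finitely generated projective: the
composition of the evaluation map to the double dual with the dual of the isomorphism
`Hom (P, M)^* ≅ Hom (M, ν P)`. -/
def serre [Module.Projective A P] : (P ⟶ M) ≃ₗ[F] Module.Dual F (M ⟶ (nu F A).obj P) :=
  Module.evalEquiv F (P ⟶ M) ≪≫ₗ
    (LinearEquiv.ofBijective (serreAux F P M) (serreAux_bijective F P M)).symm.dualMap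

/-- Serre duality sends the image `p ↦ φ p • m` of `φ ⊗ m ∈ P^∨ ⊗ M` to the functional
`h ↦ h m φ`; this determines it, since the maps `p ↦ φ p • m` span `Hom (P, M)`. -/
theorem serre_rankOne [Module.Projective A P] (φ : P →ₗ[A] A) (m : M)
    (h : M ⟶ (nu F A).obj P) :
    serre F P M (rankOne φ m) h = (show DualR F (P →ₗ[A] A) from h.hom.hom m) φ := by
  obtain ⟨ξ, rfl⟩ := (serreAux_bijective F P M).2 h
  rw [serreAux_apply]
  change (LinearEquiv.ofBijective (serreAux F P M) (serreAux_bijective F P M)).symm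
    ((LinearEquiv.ofBijective (serreAux F P M) (serreAux_bijective F P M)) ξ) (rankOne φ m) = _
  rw [LinearEquiv.symm_apply_apply]

end Serre

/-! ### The map `Δ` -/

section DeltaMap

variable (F : Type u) [Field F] {A : Type u} [Ring A] [Algebra F A] [Module.Finite F A]
variable {L R : FGModuleCat.{u} A ⥤ FGModuleCat.{u} A} (adj : L ⊣ R) [R.Additive] [R.Linear F]

/-- For an adjunction `L ⊣ R` and `P`, `Q` finitely generated projective, the composition
`Hom (P, L ^ r Q) ≅ Hom (L ^ r Q, ν P)^* ≅ Hom (Q, R ^ r (ν P))^* ≅ Hom (R ^ r (ν P), ν Q)^{**}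
≅ Hom (R ^ r (ν P), ν Q)` of Serre duality, the adjunction, Serre duality and evaluation. -/
def delta (P Q : FGModuleCat.{u} A) [Module.Projective A P] [Module.Projective A Q] (r : ℕ) :
    (P ⟶ (iterL L r).obj Q) ≃ₗ[F] ((iterR R r).obj ((nu F A).obj P) ⟶ (nu F A).obj Q) :=
  serre F P ((iterL L r).obj Q) ≪≫ₗ
    (iterHomEquiv F adj r Q ((nu F A).obj P)).symm.dualMap ≪≫ₗ
    (serre F Q ((iterR R r).obj ((nu F A).obj P))).symm.dualMap ≪≫ₗ
    (Module.evalEquiv F ((iterR R r).obj ((nu F A).obj P) ⟶ (nu F A).obj Q)).symm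

variable (A)

/-- The regular left module `A`. -/
abbrev regular : FGModuleCat.{u} A := FGModuleCat.of A A

instance : Module.Projective A (regular A) := inferInstanceAs (Module.Projective A A)

instance : Module.Finite A (DualR F A) := Module.Finite.of_restrictScalars_finite F A _

/-- The left module `A^*`, the dual of the regular right module. -/
abbrev coregular : FGModuleCat.{u} A := FGModuleCat.of A (DualR F A)

/-- The isomorphism of right modules `A ≅ A^∨`, `a ↦ (x ↦ x a)`. -/
def regularDual : A ≃ₗ[Aᵐᵒᵖ] (A →ₗ[A] A) where
  toFun a := LinearMap.toSpanSingleton A A a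
  invFun φ := φ 1
  map_add' a b := LinearMap.ext fun x => mul_add x a b
  map_smul' c a := LinearMap.ext fun x => (mul_assoc x a c.unop).symm
  left_inv a := one_mul a
  right_inv φ := LinearMap.ext fun x => by
    change x * φ 1 = φ x
    rw [← smul_eq_mul, ← map_smul, smul_eq_mul, mul_one]

/-- The isomorphism `ν A = A^{∨*} ≅ A^*` induced by `A ≅ A^∨`. -/
def nuRegular : (nu F A).obj (regular A) ≅ coregular F A where
  hom := FGModuleCat.ofHom (DualR.map F (regularDual A).toLinearMap)
  inv := FGModuleCat.ofHom (DualR.map F (regularDual A).symm.toLinearMap)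
  hom_inv_id := FGModuleCat.hom_ext <| LinearMap.ext fun ξ => DualR.ext F fun φ =>
    congrArg (show DualR F (A →ₗ[A] A) from ξ) ((regularDual A).apply_symm_apply φ)
  inv_hom_id := FGModuleCat.hom_ext <| LinearMap.ext fun ξ => DualR.ext F fun a =>
    congrArg (show DualR F A from ξ) ((regularDual A).symm_apply_apply a)

/-- The preprojective algebra `Π = ⨁ r, Hom (A, τ^{-r} A)`, in which the product of `g` in
degree `s` and `f` in degree `r` is `τ^{-r} g ∘ f`. -/
abbrev Preprojective : Type u := ⨁ r, LPiece (tauInv F A) (regular A) r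

/-- The postinjective algebra `⨁ r, Hom (τ^r A^*, A^*)`, in which the product of `g` in
degree `s` and `f` in degree `r` is `g ∘ τ^s f`. -/
abbrev Postinjective : Type u := ⨁ r, RPiece (tau F A) (coregular F A) r

/-- The element of degree `r` of the preprojective algebra given by `A → τ^{-r} A`. -/
def Preprojective.of (r : ℕ) (f : regular A ⟶ (iterL (tauInv F A) r).obj (regular A)) :
    Preprojective F A :=
  DirectSum.lof F ℕ (LPiece (tauInv F A) (regular A)) r f

/-- The element of degree `r` of the postinjective algebra given by `τ^r A^* → A^*`. -/
def Postinjective.of (r : ℕ) (g : (iterR (tau F A) r).obj (coregular F A) ⟶ coregular F A) :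
    Postinjective F A :=
  DirectSum.lof F ℕ (RPiece (tau F A) (coregular F A)) r g

/-- The degree `r` part of the preprojective algebra. -/
def Preprojective.degree (r : ℕ) : Submodule F (Preprojective F A) :=
  LinearMap.range (DirectSum.lof F ℕ (LPiece (tauInv F A) (regular A)) r)

/-- The degree `r` part of the postinjective algebra. -/
def Postinjective.degree (r : ℕ) : Submodule F (Postinjective F A) :=
  LinearMap.range (DirectSum.lof F ℕ (RPiece (tau F A) (coregular F A)) r)

variable {A}

/-- The map `Δ` in degree `r`: the map `delta` for `P = Q = A`, followed by the identification
of `ν A` with `A^*`. -/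
def deltaRegular (adj : tauInv F A ⊣ tau F A) (r : ℕ) :
    LPiece (tauInv F A) (regular A) r →ₗ[F] RPiece (tau F A) (coregular F A) r where
  toFun f := (iterR (tau F A) r).map (nuRegular F A).inv ≫
    delta F adj (regular A) (regular A) r f ≫ (nuRegular F A).hom
  map_add' f g := by
    refine (congrArg (fun k => _ ≫ k ≫ _)
      (map_add (delta F adj (regular A) (regular A) r) f g)).trans ?_
    rw [Preadditive.add_comp, Preadditive.comp_add]
    rfl
  map_smul' c f := by
    refine (congrArg (fun k => _ ≫ k ≫ _)
      (map_smul (delta F adj (regular A) (regular A) r) c f)).trans ?_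
    rw [Linear.smul_comp, Linear.comp_smul]
    rfl

/-- The map `Δ` from the preprojective to the postinjective algebra. -/
def Delta (adj : tauInv F A ⊣ tau F A) : Preprojective F A →ₗ[F] Postinjective F A :=
  DirectSum.lmap (deltaRegular F adj)

end DeltaMap

end

end HereditaryAlgebra

/-!
Write `⟨u, v⟩` for the Serre pairing of `u : P ⟶ M` with `v : M ⟶ ν P`. It is perfect, a morphism
can be moved from one argument to the other, and `Δ f` is characterised by `⟨h, Δ f⟩ = ⟨f, h♯⟩`,
where `h♯` is the adjunct of `h` under the iterated adjunction. The formula on components and the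
multiplicativity of `Δ` both follow by moving morphisms across the pairing. This argument needs
only some adjunction `L ⊣ R` of linear endofunctors.

For the adjunction `τ⁻ ⊣ τ`, both `Hom (τ⁻ M, N)` and `Hom (M, τ N)` are naturally dual to
`Ext¹ (N, M)`. Indeed `Ext¹ (N, M)` consists of the derivations of `A` into `Hom_F (N, M)` modulo
the inner ones, and transposition `Hom_F (N, M) ≅ Hom_F (M^*, N^*)` identifies it with
`Ext¹ (M^*, N^*)` over the opposite algebra. When the syzygy of `N` is projective, a dual basis
of it gives the Auslander–Reiten formula `Hom (Tr N, D M) ≅ Ext¹ (N, M)^*`.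
-/

namespace HereditaryAlgebra

noncomputable section

section IteratedAdjunction

variable {C : Type u} [Category.{v} C] {L R : C ⥤ C}

theorem iterAdj_zero_homEquiv_symm (adj : L ⊣ R) {X Y : C} (h : X ⟶ Y) :
    ((iterAdj adj 0).homEquiv X Y).symm h = h :=
  (Adjunction.homEquiv_counit ..).trans (Category.comp_id h)

theorem iterAdj_succ_homEquiv_symm (adj : L ⊣ R) (r : ℕ) {X Y : C}
    (h : X ⟶ (iterR R r).obj (R.obj Y)) :
    ((iterAdj adj (r + 1)).homEquiv X Y).symm h =
      (adj.homEquiv _ Y).symm (((iterAdj adj r).homEquiv X (R.obj Y)).symm h) :=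
  congrArg (fun e : ∀ _ _, _ => (e X Y).symm h)
    (Adjunction.comp_homEquiv (iterAdj adj r) adj)

theorem iterAdj_homEquiv_symm_add (adj : L ⊣ R) (s r : ℕ) (X Y : C)
    (h : X ⟶ (iterR R (s + r)).obj Y) :
    ((iterAdj adj (s + r)).homEquiv X Y).symm h =
      eqToHom (iterL_obj L s r X).symm ≫
        ((iterAdj adj r).homEquiv ((iterL L s).obj X) Y).symm
          (((iterAdj adj s).homEquiv X ((iterR R r).obj Y)).symm
            (h ≫ eqToHom (iterR_obj R s r Y).symm)) := by
  induction r generalizing Y with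
  | zero =>
    refine Eq.symm ((Category.id_comp _).trans ((iterAdj_zero_homEquiv_symm adj _).trans ?_))
    exact congrArg ((iterAdj adj s).homEquiv X Y).symm (Category.comp_id h)
  | succ r ih =>
    refine (iterAdj_succ_homEquiv_symm adj (s + r) h).trans ?_
    refine (congrArg (adj.homEquiv _ Y).symm (ih (R.obj Y) h)).trans ?_
    rw [Adjunction.homEquiv_naturality_left_symm, eqToHom_map]
    exact congrArg (eqToHom _ ≫ ·) (iterAdj_succ_homEquiv_symm adj r _).symm

theorem iterR_map_add (s r : ℕ) {Y Y' : C} (f : Y ⟶ Y') :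
    (iterR R (s + r)).map f = eqToHom (iterR_obj R s r Y).symm ≫
      (iterR R s).map ((iterR R r).map f) ≫ eqToHom (iterR_obj R s r Y') :=
  Functor.congr_hom (iterR_comp R s r).symm f

end IteratedAdjunction

section PostinjectiveCongr

variable (F : Type*) [Field F] {C : Type u} [Category.{v} C] [Preadditive C] [Linear F C]
variable {R : C ⥤ C} {Y Y' : C}

/-- Conjugation by an isomorphism `Y ≅ Y'`, as a map between the degree `r` parts
`Hom (R ^ r Y, Y)` and `Hom (R ^ r Y', Y')` of the algebras attached to `Y` and `Y'`. -/
def RPiece.congr (i : Y ≅ Y') (r : ℕ) : RPiece R Y r ≃ₗ[F] RPiece R Y' r where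
  toFun (f : (iterR R r).obj Y ⟶ Y) := (iterR R r).map i.inv ≫ f ≫ i.hom
  invFun (g : (iterR R r).obj Y' ⟶ Y') := (iterR R r).map i.hom ≫ g ≫ i.inv
  left_inv := (Iso.homCongr ((iterR R r).mapIso i) i).left_inv
  right_inv := (Iso.homCongr ((iterR R r).mapIso i) i).right_inv
  map_add' _ _ := (congrArg (_ ≫ ·) (Preadditive.add_comp ..)).trans (Preadditive.comp_add ..)
  map_smul' _ _ := (congrArg (_ ≫ ·) (Linear.smul_comp ..)).trans (Linear.comp_smul ..)

theorem RPiece.congr_mul (i : Y ≅ Y') {s r : ℕ} (g : (iterR R s).obj Y ⟶ Y)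
    (f : (iterR R r).obj Y ⟶ Y) :
    RPiece.congr F i (s + r) (RPiece.mul g f) =
      RPiece.mul (RPiece.congr F i s g) (RPiece.congr F i r f) := by
  have map_hom_comp_map_inv : (iterR R s).map i.hom ≫ (iterR R s).map i.inv = 𝟙 _ := by
    rw [← Functor.map_comp, Iso.hom_inv_id, CategoryTheory.Functor.map_id]
  change (iterR R (s + r)).map i.inv ≫
      (eqToHom (iterR_obj R s r Y).symm ≫ (iterR R s).map f ≫ g) ≫ i.hom =
    eqToHom (iterR_obj R s r Y').symm ≫
      (iterR R s).map ((iterR R r).map i.inv ≫ f ≫ i.hom) ≫ (iterR R s).map i.inv ≫ g ≫ i.hom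
  simp [iterR_map_add, reassoc_of% map_hom_comp_map_inv]

theorem RPiece.congr_one (i : Y ≅ Y') :
    RPiece.congr F (R := R) i 0 GradedMonoid.GOne.one = GradedMonoid.GOne.one :=
  (congrArg (i.inv ≫ ·) (Category.id_comp i.hom)).trans i.inv_hom_id

end PostinjectiveCongr

section GradedMap

variable {F : Type*} [Semiring F] {ι : Type*} [DecidableEq ι] [AddMonoid ι] {M N : ι → Type*}
variable [∀ i, AddCommMonoid (M i)] [∀ i, AddCommMonoid (N i)] [∀ i, Module F (M i)]
variable [∀ i, Module F (N i)] [DirectSum.GSemiring M] [DirectSum.GSemiring N]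

theorem lmap_mul (φ : ∀ i, M i →ₗ[F] N i)
    (hφ : ∀ {i j} (a : M i) (b : M j), φ (i + j) (GradedMonoid.GMul.mul a b) =
      GradedMonoid.GMul.mul (φ i a) (φ j b)) (x y : ⨁ i, M i) :
    DirectSum.lmap φ (x * y) = DirectSum.lmap φ x * DirectSum.lmap φ y := by
  refine (AddMonoidHom.map_mul_iff (DirectSum.lmap φ).toAddMonoidHom).2 ?_ x y
  ext i a j b : 4
  change DirectSum.lmap φ (DirectSum.of M i a * DirectSum.of M j b) =
    DirectSum.lmap φ (DirectSum.of M i a) * DirectSum.lmap φ (DirectSum.of M j b)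
  simp only [DirectSum.of_mul_of, DirectSum.lmap_of, hφ]

end GradedMap

section SerrePairing

variable (F : Type u) [Field F] {A : Type u} [Ring A] [Algebra F A] [Module.Finite F A]

theorem comp_serreAux {P M N : FGModuleCat.{u} A} (m : M ⟶ N) (ξ : Module.Dual F (P ⟶ N)) :
    m ≫ serreAux F P N ξ = serreAux F P M (ξ ∘ₗ Linear.rightComp F P m) :=
  FGModuleCat.hom_ext <| LinearMap.ext fun x => DualR.ext F fun φ => congrArg ξ <|
    FGModuleCat.hom_ext <| LinearMap.ext fun p => (map_smul m.hom.hom (φ p) x).symm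

theorem serreAux_comp_nu {P P' M : FGModuleCat.{u} A} (a : P' ⟶ P)
    (ξ : Module.Dual F (P' ⟶ M)) :
    serreAux F P' M ξ ≫ (nu F A).map a = serreAux F P M (ξ ∘ₗ Linear.leftComp F M a) :=
  rfl

theorem serre_apply_serreAux {P M : FGModuleCat.{u} A} [Module.Projective A P] (u : P ⟶ M)
    (ξ : Module.Dual F (P ⟶ M)) : serre F P M u (serreAux F P M ξ) = ξ u :=
  LinearMap.congr_fun (LinearEquiv.symm_apply_apply
    (LinearEquiv.ofBijective (serreAux F P M) (serreAux_bijective F P M)) ξ) u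

theorem serre_comp {P M N : FGModuleCat.{u} A} [Module.Projective A P] (u : P ⟶ M) (m : M ⟶ N)
    (v : N ⟶ (nu F A).obj P) : serre F P N (u ≫ m) v = serre F P M u (m ≫ v) := by
  obtain ⟨ξ, rfl⟩ := (serreAux_bijective F P N).2 v
  rw [comp_serreAux, serre_apply_serreAux, serre_apply_serreAux]
  rfl

theorem serre_nu {P P' M : FGModuleCat.{u} A} [Module.Projective A P] [Module.Projective A P']
    (a : P' ⟶ P) (u : P ⟶ M) (v : M ⟶ (nu F A).obj P') :
    serre F P' M (a ≫ u) v = serre F P M u (v ≫ (nu F A).map a) := by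
  obtain ⟨ξ, rfl⟩ := (serreAux_bijective F P' M).2 v
  rw [serreAux_comp_nu, serre_apply_serreAux, serre_apply_serreAux]
  rfl

theorem ext_of_serre {P M : FGModuleCat.{u} A} [Module.Projective A P]
    {v w : M ⟶ (nu F A).obj P} (h : ∀ u, serre F P M u v = serre F P M u w) : v = w := by
  obtain ⟨ξ, rfl⟩ := (serreAux_bijective F P M).2 v
  obtain ⟨η, rfl⟩ := (serreAux_bijective F P M).2 w
  simp only [serre_apply_serreAux] at h
  exact congrArg _ (LinearMap.ext h)

end SerrePairing

section DeltaProperties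

variable (F : Type u) [Field F] {A : Type u} [Ring A] [Algebra F A] [Module.Finite F A]
variable {L R : FGModuleCat.{u} A ⥤ FGModuleCat.{u} A} (adj : L ⊣ R) [R.Additive] [R.Linear F]

theorem serre_delta (P Q : FGModuleCat.{u} A) [Module.Projective A P] [Module.Projective A Q]
    (r : ℕ) (f : P ⟶ (iterL L r).obj Q) (h : Q ⟶ (iterR R r).obj ((nu F A).obj P)) :
    serre F Q _ h (delta F adj P Q r f) =
      serre F P _ f (((iterAdj adj r).homEquiv _ _).symm h) := by
  refine (Module.apply_evalEquiv_symm_apply ..).trans ?_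
  exact congrArg (fun k => serre F P _ f (((iterAdj adj r).homEquiv _ _).symm k))
    ((serre F Q _).symm_apply_apply h)

theorem delta_comp (P Q P' Q' : FGModuleCat.{u} A) [Module.Projective A P]
    [Module.Projective A Q] [Module.Projective A P'] [Module.Projective A Q'] (r : ℕ)
    (a : P' ⟶ P) (b : Q ⟶ Q') (f : P ⟶ (iterL L r).obj Q) :
    delta F adj P' Q' r (a ≫ f ≫ (iterL L r).map b) =
      (iterR R r).map ((nu F A).map a) ≫ delta F adj P Q r f ≫ (nu F A).map b := by
  refine ext_of_serre F fun h => ?_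
  rw [serre_delta, ← serre_comp, ← serre_nu, serre_delta,
    Adjunction.homEquiv_naturality_left_symm, Adjunction.homEquiv_naturality_right_symm,
    serre_nu, serre_comp]

theorem delta_mul (P Q S : FGModuleCat.{u} A) [Module.Projective A P]
    [Module.Projective A Q] [Module.Projective A S] (s r : ℕ)
    (f : P ⟶ (iterL L r).obj Q) (g : Q ⟶ (iterL L s).obj S) :
    delta F adj P S (s + r) (f ≫ (iterL L r).map g ≫ eqToHom (iterL_obj L s r S)) =
      eqToHom (iterR_obj R s r _).symm ≫ (iterR R s).map (delta F adj P Q r f) ≫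
        delta F adj Q S s g := by
  refine ext_of_serre F fun h => ?_
  rw [serre_delta, iterAdj_homEquiv_symm_add, ← serre_comp, ← serre_comp, ← serre_comp, serre_delta,
    Adjunction.homEquiv_naturality_right_symm, ← serre_comp, serre_delta,
    Adjunction.homEquiv_naturality_left_symm _ g, ← serre_comp]
  simp only [Category.assoc, eqToHom_trans, eqToHom_refl, Category.comp_id]

theorem delta_one (P : FGModuleCat.{u} A) [Module.Projective A P] :
    delta F adj P P 0 (𝟙 P) = 𝟙 ((nu F A).obj P) := by
  refine ext_of_serre F fun (h : P ⟶ (nu F A).obj P) => ?_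
  calc serre F P _ h (delta F adj P P 0 (𝟙 P))
      = serre F P _ (𝟙 P) (((iterAdj adj 0).homEquiv _ _).symm h) := serre_delta F adj P P 0 _ h
    _ = serre F P _ (𝟙 P) h := by rw [iterAdj_zero_homEquiv_symm]
    _ = serre F P _ h (𝟙 _) := by
      simpa only [Category.id_comp, Category.comp_id] using (serre_comp F (𝟙 P) h (𝟙 _)).symm

end DeltaProperties

section DeltaIsomorphism

variable (F : Type u) [Field F] {A : Type u} [Ring A] [Algebra F A] [Module.Finite F A]
variable {L R : FGModuleCat.{u} A ⥤ FGModuleCat.{u} A} (adj : L ⊣ R) [R.Additive] [R.Linear F]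
variable {X Y : FGModuleCat.{u} A} [Module.Projective A X] (i : (nu F A).obj X ≅ Y)

/-- The degree `r` part of `Δ` for an arbitrary adjunction `L ⊣ R`, projective `X` and
identification `i : ν X ≅ Y`; the case `X = A`, `Y = A^*` is `deltaRegular`. -/
def deltaPiece (r : ℕ) : LPiece L X r ≃ₗ[F] RPiece R Y r :=
  delta F adj X X r ≪≫ₗ RPiece.congr F i r

/-- The map `Δ` for an arbitrary adjunction `L ⊣ R`, projective `X` and identification
`i : ν X ≅ Y`; the case `X = A`, `Y = A^*` is `Delta`. -/
def deltaSum : (⨁ r, LPiece L X r) ≃ₗ[F] ⨁ r, RPiece R Y r :=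
  DFinsupp.mapRange.linearEquiv (deltaPiece F adj i)

theorem deltaSum_mul [L.Additive] (x y : ⨁ r, LPiece L X r) :
    deltaSum F adj i (x * y) = deltaSum F adj i x * deltaSum F adj i y :=
  lmap_mul (fun r => (deltaPiece F adj i r).toLinearMap) (fun {s r} g f =>
    (congrArg (RPiece.congr F i (s + r)) (delta_mul F adj X X X s r f g)).trans
      (RPiece.congr_mul F i (delta F adj X X s g) (delta F adj X X r f))) x y

theorem deltaSum_one : deltaSum F adj i 1 = 1 :=
  (DirectSum.lmap_of ..).trans <| congrArg (DirectSum.of (RPiece R Y) 0) <|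
    (congrArg (RPiece.congr F i 0) (delta_one F adj X)).trans (RPiece.congr_one F i)

/-- `deltaSum` as an isomorphism of algebras. -/
def deltaAlgEquiv [L.Additive] [L.Linear F] : (⨁ r, LPiece L X r) ≃ₐ[F] ⨁ r, RPiece R Y r :=
  AlgEquiv.ofLinearEquiv (deltaSum F adj i) (deltaSum_one F adj i) (deltaSum_mul F adj i)

theorem deltaSum_lof (r : ℕ) (f : LPiece L X r) :
    deltaSum F adj i (DirectSum.lof F ℕ _ r f) =
      DirectSum.lof F ℕ _ r (deltaPiece F adj i r f) :=
  DirectSum.lmap_lof _ _ _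

theorem map_range_lof_deltaSum (r : ℕ) :
    (LinearMap.range (DirectSum.lof F ℕ (LPiece L X) r)).map (deltaSum F adj i).toLinearMap =
      LinearMap.range (DirectSum.lof F ℕ (RPiece R Y) r) := by
  have comp_lof : (deltaSum F adj i).toLinearMap ∘ₗ DirectSum.lof F ℕ _ r =
      DirectSum.lof F ℕ _ r ∘ₗ (deltaPiece F adj i r).toLinearMap :=
    LinearMap.ext (deltaSum_lof F adj i r)
  rw [← LinearMap.range_comp, comp_lof,
    LinearMap.range_comp_of_range_eq_top _ (LinearEquiv.range _)]

theorem deltaPiece_comp (P Q : FGModuleCat.{u} A) [Module.Projective A P] [Module.Projective A Q]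
    (r : ℕ) (a : X ⟶ P) (b : Q ⟶ X) (f : P ⟶ (iterL L r).obj Q) :
    deltaPiece F adj i r (a ≫ f ≫ (iterL L r).map b) =
      (iterR R r).map (i.inv ≫ (nu F A).map a) ≫
        delta F adj P Q r f ≫ (nu F A).map b ≫ i.hom := by
  refine (congrArg (RPiece.congr F i r) (delta_comp F adj P Q X X r a b f)).trans ?_
  change (iterR R r).map i.inv ≫
    ((iterR R r).map ((nu F A).map a) ≫ delta F adj P Q r f ≫ (nu F A).map b) ≫ i.hom = _
  simp only [Functor.map_comp, Category.assoc]

end DeltaIsomorphism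

theorem proposition3p3_general {F A : Type u} [Field F] [Ring A] [Algebra F A]
    [Module.Finite F A] {L R : FGModuleCat.{u} A ⥤ FGModuleCat.{u} A} [L.Additive] [L.Linear F]
    [R.Additive] [R.Linear F] (adj : L ⊣ R) {X Y : FGModuleCat.{u} A} [Module.Projective A X]
    (i : (nu F A).obj X ≅ Y) :
    (∃ e : (⨁ r, LPiece L X r) ≃ₐ[F] ⨁ r, RPiece R Y r, ∀ x, e x = deltaSum F adj i x) ∧
      (∀ r : ℕ, (LinearMap.range (DirectSum.lof F ℕ (LPiece L X) r)).map
        (deltaSum F adj i).toLinearMap = LinearMap.range (DirectSum.lof F ℕ (RPiece R Y) r)) ∧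
      ∀ (P Q : FGModuleCat.{u} A) [Module.Projective A P] [Module.Projective A Q] (r : ℕ)
        (a : X ⟶ P) (b : Q ⟶ X) (f : P ⟶ (iterL L r).obj Q),
        deltaSum F adj i (DirectSum.lof F ℕ (LPiece L X) r (a ≫ f ≫ (iterL L r).map b)) =
          DirectSum.lof F ℕ (RPiece R Y) r ((iterR R r).map (i.inv ≫ (nu F A).map a) ≫
            delta F adj P Q r f ≫ (nu F A).map b ≫ i.hom) :=
  ⟨⟨deltaAlgEquiv F adj i, fun _ => rfl⟩, map_range_lof_deltaSum F adj i,
    fun P Q _ _ r a b f => (deltaSum_lof F adj i r _).trans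
      (congrArg (DirectSum.lof F ℕ _ r) (deltaPiece_comp F adj i P Q r a b f))⟩

section Derivations

variable (F : Type u) [Field F] (A : Type u) [Ring A] [Algebra F A]
variable (N M : Type u) [AddCommGroup N] [Module F N] [Module A N] [IsScalarTower F A N]
  [AddCommGroup M] [Module F M] [Module A M] [IsScalarTower F A M]

/-- The `F`-linear retraction `y ↦ y - 1 ⊗ cover y` of the free cover onto its kernel. -/
def syzProj : A ⊗[F] N →ₗ[F] Syz F A N where
  toFun y := ⟨y - 1 ⊗ₜ cover F A N y, by simp [cover]⟩
  map_add' y z := Subtype.ext <| by simp [TensorProduct.tmul_add]; abel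
  map_smul' c y := Subtype.ext <|
    show c • y - 1 ⊗ₜ cover F A N (c • y) = c • (y - 1 ⊗ₜ cover F A N y) by
      rw [LinearMap.map_smul_of_tower, TensorProduct.tmul_smul, smul_sub]

/-- The `F`-linear maps `δ : A → Hom_F (N, M)` with `δ (a b) = a δ b + δ a b`, that is, the
derivations of `A` with values in the bimodule `Hom_F (N, M)`. -/
def HomDer : Submodule F (A →ₗ[F] N →ₗ[F] M) where
  carrier := {δ | ∀ a b n, δ (a * b) n = a • δ b n + δ a (b • n)}
  zero_mem' a b n := by simp
  add_mem' {δ ε} hδ hε a b n := by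
    simp only [LinearMap.add_apply, hδ a b n, hε a b n, smul_add]
    abel
  smul_mem' c δ hδ a b n := by
    simp only [LinearMap.smul_apply, hδ a b n, smul_add, smul_comm c a]

/-- The inner derivation `a ↦ a f - f a` attached to `f ∈ Hom_F (N, M)`. -/
def innerDer : (N →ₗ[F] M) →ₗ[F] HomDer F A N M where
  toFun f :=
    ⟨LinearMap.mk₂ F (fun a n => a • f n - f (a • n))
      (fun a b n => by simp only [add_smul, map_add]; abel)
      (fun c a n => by simp only [smul_assoc, map_smul, smul_sub])
      (fun a n p => by simp only [smul_add, map_add]; abel)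
      (fun c a n => by simp only [map_smul, smul_comm a c, smul_sub]),
    fun a b n => by simp only [LinearMap.mk₂_apply, mul_smul, smul_sub]; abel⟩
  map_add' f g := Subtype.ext <| LinearMap.ext₂ fun a n =>
    show a • (f n + g n) - (f (a • n) + g (a • n)) = _ by rw [smul_add, add_sub_add_comm]; rfl
  map_smul' c f := Subtype.ext <| LinearMap.ext₂ fun a n =>
    show a • c • f n - c • f (a • n) = _ by rw [smul_comm, ← smul_sub]; rfl

variable {F A N M}

theorem syzProj_coe (x : Syz F A N) : syzProj F A N (x : A ⊗[F] N) = x :=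
  Subtype.ext <| show (x : A ⊗[F] N) - (1 : A) ⊗ₜ[F] cover F A N x = x by
    rw [LinearMap.mem_ker.1 x.2, TensorProduct.tmul_zero, sub_zero]

theorem syzProj_mul_tmul (a b : A) (n : N) : syzProj F A N ((a * b) ⊗ₜ n) =
    a • syzProj F A N (b ⊗ₜ n) + syzProj F A N (a ⊗ₜ (b • n)) :=
  Subtype.ext <| by
    simp [syzProj, cover, smul_sub, TensorProduct.smul_tmul', mul_smul]

theorem syz_hom_ext {G : Type*} [AddCommGroup G] {u v : Syz F A N →+ G}
    (h : ∀ a n, u (syzProj F A N (a ⊗ₜ n)) = v (syzProj F A N (a ⊗ₜ n))) : u = v := by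
  refine AddMonoidHom.ext fun x => ?_
  rw [← syzProj_coe x]
  induction (x : A ⊗[F] N) with
  | zero => simp only [map_zero]
  | add y z hy hz => simp only [map_add, hy, hz]
  | tmul a n => exact h a n

omit [IsScalarTower F A N] in
theorem HomDer.map_one (δ : HomDer F A N M) (n : N) : δ.1 1 n = 0 := by
  simpa using δ.2 1 1 n

theorem HomDer.lift_smul (δ : HomDer F A N M) (b : A) (x : A ⊗[F] N) :
    TensorProduct.lift δ.1 (b • x) =
      b • TensorProduct.lift δ.1 x + δ.1 b (cover F A N x) := by
  induction x with
  | zero => simp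
  | add x y hx hy => simp only [smul_add, map_add, hx, hy]; abel
  | tmul a n => simpa [cover, TensorProduct.smul_tmul'] using δ.2 b a n

variable (F A N M)

/-- Maps out of the syzygy are derivations: `u` corresponds to `a ↦ (n ↦ u (a ⊗ n - 1 ⊗ a n))`. -/
def derEquiv : (Syz F A N →ₗ[A] M) ≃ₗ[F] HomDer F A N M where
  toFun u := ⟨TensorProduct.curry (u.restrictScalars F ∘ₗ syzProj F A N), fun a b n =>
    show u (syzProj F A N ((a * b) ⊗ₜ n)) =
        a • u (syzProj F A N (b ⊗ₜ n)) + u (syzProj F A N (a ⊗ₜ (b • n))) by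
      rw [syzProj_mul_tmul, map_add, map_smul]⟩
  map_add' _ _ := rfl
  map_smul' _ _ := rfl
  invFun δ :=
    { toFun := fun x => TensorProduct.lift δ.1 x
      map_add' := fun x y => map_add (TensorProduct.lift δ.1) (x : A ⊗[F] N) y
      map_smul' := fun a x => by
        rw [Submodule.coe_smul, HomDer.lift_smul δ, LinearMap.mem_ker.1 x.2, map_zero, add_zero]
        rfl }
  left_inv u := LinearMap.ext fun x => by
    change TensorProduct.lift (TensorProduct.curry (u.restrictScalars F ∘ₗ syzProj F A N))
      (x : A ⊗[F] N) = u x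
    rw [show TensorProduct.lift (TensorProduct.curry (u.restrictScalars F ∘ₗ syzProj F A N)) =
      u.restrictScalars F ∘ₗ syzProj F A N from TensorProduct.ext' fun _ _ => rfl]
    exact congrArg u (syzProj_coe x)
  right_inv δ := Subtype.ext <| LinearMap.ext₂ fun a n => by
    change TensorProduct.lift δ.1 (a ⊗ₜ n - 1 ⊗ₜ cover F A N (a ⊗ₜ n)) = δ.1 a n
    rw [map_sub, TensorProduct.lift.tmul, TensorProduct.lift.tmul, HomDer.map_one δ, sub_zero]

theorem map_derEquiv_range_precomp :
    (LinearMap.range (precomp F (W := M) (Syz F A N).subtype)).map (derEquiv F A N M).toLinearMap =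
      LinearMap.range (innerDer F A N M) := by
  let ev : (A ⊗[F] N →ₗ[A] M) →ₗ[F] N →ₗ[F] M :=
    { toFun := fun ψ => ψ.restrictScalars F ∘ₗ TensorProduct.mk F A N 1
      map_add' := fun _ _ => rfl
      map_smul' := fun _ _ => rfl }
  have surjective_ev : LinearMap.range ev = ⊤ := LinearMap.range_eq_top.2 fun f =>
    ⟨cover F A M ∘ₗ TensorProduct.AlgebraTensorModule.lTensor A A f, LinearMap.ext fun n => by
      change cover F A M (1 ⊗ₜ f n) = f n
      simp [cover]⟩
  have derEquiv_restrict : (derEquiv F A N M).toLinearMap ∘ₗ precomp F (Syz F A N).subtype =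
      innerDer F A N M ∘ₗ ev := by
    refine LinearMap.ext fun ψ => Subtype.ext <| LinearMap.ext₂ fun a n => ?_
    change ψ (a ⊗ₜ n - 1 ⊗ₜ cover F A N (a ⊗ₜ n)) = a • ψ (1 ⊗ₜ n) - ψ (1 ⊗ₜ (a • n))
    rw [← map_smul, ← map_sub, TensorProduct.smul_tmul', smul_eq_mul, mul_one]
    simp [cover]
  rw [← LinearMap.range_comp, derEquiv_restrict,
    LinearMap.range_comp_of_range_eq_top _ surjective_ev]

end Derivations

section Transposition

variable (F : Type u) [Field F] (A : Type u) [Ring A] [Algebra F A]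
variable (N M : Type u) [AddCommGroup N] [Module F N] [AddCommGroup M] [Module F M]

theorem DualL.eq_of_forall_apply {M : Type u} [AddCommGroup M] [Module F M] {x y : M}
    (h : ∀ ξ : DualL F M, ξ x = ξ y) : x = y :=
  sub_eq_zero.1 <| (Module.forall_dual_apply_eq_zero_iff F (x - y)).1 fun ξ =>
    (map_sub ξ x y).trans (sub_eq_zero.2 (h ξ))

variable [Module.Finite F M]

/-- The transposition `f ↦ f^*` from `Hom_F (N, M)` to `Hom_F (M^*, N^*)`. -/
def transposeHom : (N →ₗ[F] M) ≃ₗ[F] (DualL F M →ₗ[F] DualL F N) :=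
  LinearEquiv.congrRight (Module.evalEquiv F M) ≪≫ₗ
    (LinearMap.lflip : (N →ₗ[F] Module.Dual F M →ₗ[F] F) ≃ₗ[F] _)

variable [Module A N] [IsScalarTower F A N] [Module A M] [IsScalarTower F A M]

/-- The transposition of derivations, valued in the opposite algebra. -/
def derTranspose : HomDer F A N M ≃ₗ[F] HomDer F Aᵐᵒᵖ (DualL F M) (DualL F N) :=
  LinearEquiv.ofSubmodules
    (LinearEquiv.arrowCongr (MulOpposite.opLinearEquiv F) (transposeHom F N M)) _ _ <| by
    have mem_iff (δ : A →ₗ[F] N →ₗ[F] M) :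
        LinearEquiv.arrowCongr (MulOpposite.opLinearEquiv F) (transposeHom F N M) δ ∈
          HomDer F Aᵐᵒᵖ (DualL F M) (DualL F N) ↔ δ ∈ HomDer F A N M := by
      refine ⟨fun h a b n => DualL.eq_of_forall_apply F fun ξ => ?_,
        fun h a b ξ => DualL.ext F fun n => ?_⟩
      · refine (DFunLike.congr_fun (h (.op b) (.op a) ξ) n).trans ?_
        rw [map_add, add_comm]
        rfl
      · refine (congrArg ξ (h b.unop a.unop n)).trans ?_
        rw [map_add, add_comm]
        rfl
    rw [← Submodule.map_comap_eq_of_surjective (LinearEquiv.surjective (LinearEquiv.arrowCongr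
      (MulOpposite.opLinearEquiv F) (transposeHom F N M))) (HomDer F Aᵐᵒᵖ (DualL F M) (DualL F N))]
    exact congrArg _ (Submodule.ext fun δ => (mem_iff δ).symm)

theorem map_derTranspose_range_innerDer :
    (LinearMap.range (innerDer F A N M)).map (derTranspose F A N M).toLinearMap =
      LinearMap.range (innerDer F Aᵐᵒᵖ (DualL F M) (DualL F N)) := by
  have derTranspose_innerDer : (derTranspose F A N M).toLinearMap ∘ₗ innerDer F A N M =
      innerDer F Aᵐᵒᵖ (DualL F M) (DualL F N) ∘ₗ
        (transposeHom F N M ≪≫ₗ LinearEquiv.neg F).toLinearMap := by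
    refine LinearMap.ext fun f => Subtype.ext <| LinearMap.ext₂ fun a ξ => DualL.ext F fun n => ?_
    change ξ (a.unop • f n - f (a.unop • n)) =
      -ξ (f (a.unop • n)) - -ξ (a.unop • f n)
    rw [map_sub, neg_sub_neg]
  rw [← LinearMap.range_comp, derTranspose_innerDer,
    LinearMap.range_comp_of_range_eq_top _ (LinearEquiv.range _)]

/-- The transposition of maps out of the syzygy, read off from the transposition of derivations. -/
def syzTranspose : (Syz F A N →ₗ[A] M) ≃ₗ[F] (Syz F Aᵐᵒᵖ (DualL F M) →ₗ[Aᵐᵒᵖ] DualL F N) :=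
  derEquiv F A N M ≪≫ₗ derTranspose F A N M ≪≫ₗ (derEquiv F Aᵐᵒᵖ (DualL F M) (DualL F N)).symm

/-- The isomorphism `Ext¹ (N, M) ≅ Ext¹ (M^*, N^*)`. -/
def ExtOne.transposeEquiv :
    ExtOne F A F N M ≃ₗ[F] ExtOne F Aᵐᵒᵖ F (DualL F M) (DualL F N) :=
  Submodule.Quotient.equiv _ _ (syzTranspose F A N M) <| by
    rw [syzTranspose, LinearEquiv.coe_trans, LinearEquiv.coe_trans, Submodule.map_comp,
      Submodule.map_comp, map_derEquiv_range_precomp, map_derTranspose_range_innerDer,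
      ← map_derEquiv_range_precomp, ← Submodule.map_comp, LinearEquiv.symm_comp,
      Submodule.map_id]

variable {F A N M}

theorem syzTranspose_apply (u : Syz F A N →ₗ[A] M) (a : Aᵐᵒᵖ) (ξ : DualL F M) (n : N) :
    syzTranspose F A N M u (syzProj F Aᵐᵒᵖ (DualL F M) (a ⊗ₜ ξ)) n =
      ξ (u (syzProj F A N (a.unop ⊗ₜ n))) := by
  have := congrArg (fun δ => δ.1 a ξ) ((derEquiv F Aᵐᵒᵖ (DualL F M) (DualL F N)).apply_symm_apply
    (derTranspose F A N M (derEquiv F A N M u)))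
  exact DFunLike.congr_fun this n

end Transposition

section Naturality

variable (F : Type u) [Field F] {A : Type u} [Ring A] [Algebra F A]
variable {N N' M M' : Type u}
  [AddCommGroup N] [Module F N] [Module A N] [IsScalarTower F A N]
  [AddCommGroup N'] [Module F N'] [Module A N'] [IsScalarTower F A N']
  [AddCommGroup M] [Module F M] [Module A M] [IsScalarTower F A M]
  [AddCommGroup M'] [Module F M'] [Module A M'] [IsScalarTower F A M']

/-- The covariant functoriality of `Ext¹ (N, -)`. -/
def ExtOne.push (g : M →ₗ[A] M') : ExtOne F A F N M →ₗ[F] ExtOne F A F N M' :=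
  Submodule.mapQ _ _
    { toFun := fun u => g ∘ₗ u
      map_add' := fun u v => LinearMap.comp_add u v g
      map_smul' := fun c u => LinearMap.ext fun x => g.map_smul_of_tower c (u x) } <| by
    rintro _ ⟨ψ, rfl⟩
    exact ⟨g ∘ₗ ψ, rfl⟩

theorem Syz.map_syzProj (f : N →ₗ[A] N') (a : A) (n : N) :
    Syz.map F f (syzProj F A N (a ⊗ₜ n)) = syzProj F A N' (a ⊗ₜ f n) :=
  Subtype.ext <| by simp [Syz.map_coe, syzProj, cover]

theorem syzTranspose_comp_map [Module.Finite F M] (u : Syz F A N' →ₗ[A] M) (f : N →ₗ[A] N') :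
    syzTranspose F A N M (u ∘ₗ Syz.map F f) = DualL.map F f ∘ₗ syzTranspose F A N' M u := by
  refine LinearMap.toAddMonoidHom_injective <| syz_hom_ext fun a ξ => DualL.ext F fun n => ?_
  refine (syzTranspose_apply _ a ξ n).trans ?_
  refine Eq.trans ?_ (syzTranspose_apply u a ξ (f n)).symm
  rw [LinearMap.comp_apply, Syz.map_syzProj]

theorem syzTranspose_comp [Module.Finite F M] [Module.Finite F M'] (g : M →ₗ[A] M')
    (u : Syz F A N →ₗ[A] M) :
    syzTranspose F A N M' (g ∘ₗ u) = syzTranspose F A N M u ∘ₗ Syz.map F (DualL.map F g) := by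
  refine LinearMap.toAddMonoidHom_injective <| syz_hom_ext fun a ξ => DualL.ext F fun n => ?_
  refine (syzTranspose_apply _ a ξ n).trans ?_
  refine (syzTranspose_apply u a (DualL.map F g ξ) n).symm.trans ?_
  exact (congrArg (fun x => syzTranspose F A N M u x n) (Syz.map_syzProj F _ a ξ)).symm

theorem ExtOne.transposeEquiv_map [Module.Finite F M] (f : N →ₗ[A] N') (x : ExtOne F A F N' M) :
    transposeEquiv F A N M (ExtOne.map F F M f x) =
      push F (DualL.map F f) (transposeEquiv F A N' M x) := by
  obtain ⟨u, rfl⟩ := Submodule.Quotient.mk_surjective _ x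
  exact congrArg Submodule.Quotient.mk (syzTranspose_comp_map F u f)

theorem ExtOne.transposeEquiv_push [Module.Finite F M] [Module.Finite F M'] (g : M →ₗ[A] M')
    (x : ExtOne F A F N M) :
    transposeEquiv F A N M' (push F g x) =
      ExtOne.map F F (DualL F N) (DualL.map F g) (transposeEquiv F A N M x) := by
  obtain ⟨u, rfl⟩ := Submodule.Quotient.mk_surjective _ x
  exact congrArg Submodule.Quotient.mk (syzTranspose_comp F g u)

end Naturality

section HomDuality

/-- An `A`-module `W` with a commuting action of a copy `B` of the opposite ring of `A`, together
with an isomorphism `W ≅ A` turning the action of `B` into right multiplication.  The two cases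
needed are the regular bimodule over `A` and over `Aᵐᵒᵖ`; in the latter `B = A`, which is only
isomorphic to the opposite ring of `Aᵐᵒᵖ`. -/
structure RegularBimodule (A B W : Type*) [Ring A] [Ring B] [AddCommGroup W] [Module A W]
    [Module B W] where
  /-- The identification of `B` with the opposite ring. -/
  op : A ≃ B
  /-- The trivialization of `W`. -/
  triv : W ≃ₗ[A] A
  triv_op_smul : ∀ a w, triv (op a • w) = triv w * a

/-- An identification of a `B`-module `D` with the `F`-dual of an `A`-module `M`, where `B` is
identified with the opposite ring of `A` by `op`. -/
structure DualModule (F : Type*) {A B : Type*} [Field F] [Ring A] [Ring B] (op : A ≃ B)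
    (M D : Type*) [AddCommGroup M] [Module F M] [Module A M] [AddCommGroup D] [Module B D] where
  /-- The underlying identification of additive groups. -/
  toDual : D ≃+ Module.Dual F M
  toDual_op_smul : ∀ a d m, toDual (op a • d) m = toDual d (a • m)

variable {F : Type u} [Field F] {A B : Type u} [Ring A] [Algebra F A] [Ring B]
variable {M M' W D D' : Type u} [AddCommGroup M] [Module F M] [Module A M] [IsScalarTower F A M]
  [AddCommGroup M'] [Module F M'] [Module A M'] [IsScalarTower F A M']
  [AddCommGroup W] [Module A W] [Module B W] [SMulCommClass A B W]
  [AddCommGroup D] [Module B D] [AddCommGroup D'] [Module B D']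
variable {P P' : Type u} [AddCommMonoid P] [Module A P] [AddCommMonoid P'] [Module A P']
variable (R : RegularBimodule A B W) (S : DualModule F R.op M D) (S' : DualModule F R.op M' D')

/-- The map `p ↦ φ p • m`, for `φ : P → W ≅ A`. -/
def RegularBimodule.rankOne (φ : P →ₗ[A] W) (m : M) : P →ₗ[A] M :=
  LinearMap.toSpanSingleton A M m ∘ₗ R.triv.toLinearMap ∘ₗ φ

omit [SMulCommClass A B W] in
theorem RegularBimodule.rankOne_apply (φ : P →ₗ[A] W) (m : M) (p : P) :
    R.rankOne φ m p = R.triv (φ p) • m := rfl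

omit [SMulCommClass A B W] in
theorem RegularBimodule.exists_dual_basis (P : Type u) [AddCommGroup P] [Module A P]
    [Module.Finite A P] [Module.Projective A P] :
    ∃ (n : ℕ) (c : Fin n → (P →ₗ[A] W)) (b : Fin n → P), ∀ x, ∑ k, R.triv (c k x) • b k = x := by
  obtain ⟨n, c, b, h⟩ := HereditaryAlgebra.exists_dual_basis (FGModuleCat.of A P)
  exact ⟨n, fun k => R.triv.symm.toLinearMap ∘ₗ c k, b, fun x => by simpa using h x⟩

/-- The duality `Hom_A (P, M)^* → Hom_B (Hom_A (P, W), D)` with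
`homDuality θ φ m = θ (p ↦ φ p • m)`, when `D` is the dual of `M`. -/
def homDuality (θ : Module.Dual F (P →ₗ[A] M)) : (P →ₗ[A] W) →ₗ[B] D where
  toFun φ := S.toDual.symm
    { toFun := fun m => θ (R.rankOne φ m)
      map_add' := fun m n => by
        rw [← map_add]
        exact congrArg θ (LinearMap.ext fun p => smul_add _ m n)
      map_smul' := fun c m => by
        rw [RingHom.id_apply, ← map_smul]
        exact congrArg θ (LinearMap.ext fun p => smul_comm _ c m) }
  map_add' φ ψ := S.toDual.injective <| LinearMap.ext fun m => by
    rw [map_add, LinearMap.add_apply]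
    simp only [AddEquiv.apply_symm_apply, LinearMap.coe_mk, AddHom.coe_mk]
    rw [← map_add]
    exact congrArg θ (LinearMap.ext fun p => by
      simp only [RegularBimodule.rankOne_apply, LinearMap.add_apply, map_add, add_smul])
  map_smul' b φ := S.toDual.injective <| LinearMap.ext fun m => by
    obtain ⟨a, rfl⟩ := R.op.surjective b
    rw [RingHom.id_apply, S.toDual_op_smul]
    simp only [AddEquiv.apply_symm_apply, LinearMap.coe_mk, AddHom.coe_mk]
    exact congrArg θ (LinearMap.ext fun p => by
      simp only [RegularBimodule.rankOne_apply, LinearMap.smul_apply, R.triv_op_smul, mul_smul])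

theorem homDuality_apply (θ : Module.Dual F (P →ₗ[A] M)) (φ : P →ₗ[A] W) (m : M) :
    S.toDual (homDuality R S θ φ) m = θ (R.rankOne φ m) :=
  LinearMap.congr_fun (S.toDual.apply_symm_apply _) m

theorem homDuality_precomp (θ : Module.Dual F (P →ₗ[A] M)) (f : P →ₗ[A] P') :
    homDuality R S (θ ∘ₗ precomp F f) = homDuality R S θ ∘ₗ precomp B f :=
  LinearMap.ext fun φ => S.toDual.injective <| LinearMap.ext fun m =>
    (homDuality_apply R S _ φ m).trans (homDuality_apply R S θ (φ ∘ₗ f) m).symm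

theorem homDuality_bijective (P : Type u) [AddCommGroup P] [Module A P] [Module.Finite A P]
    [Module.Projective A P] :
    Function.Bijective (homDuality R S : Module.Dual F (P →ₗ[A] M) → _) := by
  obtain ⟨n, c, b, dual_basis⟩ := R.exists_dual_basis P
  constructor
  · intro θ θ' h
    refine LinearMap.ext fun u => ?_
    have u_eq_sum : u = ∑ k, R.rankOne (c k) (u (b k)) := LinearMap.ext fun x => by
      conv_lhs => rw [← dual_basis x, map_sum]
      simp only [map_smul, LinearMap.sum_apply, RegularBimodule.rankOne_apply]
    rw [u_eq_sum, map_sum, map_sum]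
    exact Finset.sum_congr rfl fun k _ => by rw [← homDuality_apply R S, h, homDuality_apply]
  · intro g
    refine ⟨∑ k, S.toDual (g (c k)) ∘ₗ LinearMap.applyₗ' F (b k), LinearMap.ext fun φ =>
      S.toDual.injective <| LinearMap.ext fun m => ?_⟩
    have φ_eq_sum : φ = ∑ k, R.op (R.triv (φ (b k))) • c k := LinearMap.ext fun x =>
      R.triv.injective <| by
        conv_lhs => rw [← dual_basis x, map_sum, map_sum]
        simp only [map_smul, LinearMap.sum_apply, LinearMap.smul_apply, map_sum, R.triv_op_smul,
          smul_eq_mul]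
    conv_rhs => rw [φ_eq_sum, map_sum, map_sum, LinearMap.sum_apply]
    rw [homDuality_apply, LinearMap.sum_apply]
    refine Finset.sum_congr rfl fun k _ => ?_
    rw [map_smul, S.toDual_op_smul]
    rfl

variable {N N' : Type u} [AddCommGroup N] [Module F N] [Module A N] [IsScalarTower F A N]
  [AddCommGroup N'] [Module F N'] [Module A N'] [IsScalarTower F A N']

/-- The map `Ext¹_A (N, M)^* → Hom_B (Ext¹_A (N, W), D)` induced by `homDuality`, when `D` is the
dual of `M`.  It is the Auslander-Reiten formula. -/
def extDuality (θ : Module.Dual F (ExtOne F A F N M)) : ExtOne F A B N W →ₗ[B] D :=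
  Submodule.liftQ _ (homDuality R S (P := Syz F A N) (θ ∘ₗ Submodule.mkQ _)) <| by
    rintro _ ⟨ψ, rfl⟩
    refine S.toDual.injective <| LinearMap.ext fun m => ?_
    rw [homDuality_apply, map_zero]
    exact (congrArg θ ((Submodule.Quotient.mk_eq_zero _).2 ⟨R.rankOne ψ m, rfl⟩)).trans
      (map_zero θ)

theorem extDuality_mk (θ : Module.Dual F (ExtOne F A F N M)) (φ : Syz F A N →ₗ[A] W) (m : M) :
    S.toDual (extDuality R S θ (Submodule.Quotient.mk φ)) m =
      θ (Submodule.Quotient.mk (R.rankOne φ m)) :=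
  homDuality_apply R S _ φ m

theorem extDuality_bijective [Module.Finite F A] [Module.Finite F N]
    [Module.Projective A (Syz F A N)] :
    Function.Bijective (extDuality R S : Module.Dual F (ExtOne F A F N M) → _) := by
  have := finite_syz F (A := A) N
  have : Module.Finite A (Syz F A N) := Module.Finite.of_restrictScalars_finite F A _
  constructor
  · intro θ θ' h
    have comp_mkQ_eq : homDuality R S (P := Syz F A N) (θ ∘ₗ Submodule.mkQ _) =
        homDuality R S (θ' ∘ₗ Submodule.mkQ _) :=
      LinearMap.ext fun φ => LinearMap.congr_fun h (Submodule.Quotient.mk φ)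
    refine LinearMap.ext fun x => ?_
    obtain ⟨u, rfl⟩ := Submodule.Quotient.mk_surjective _ x
    exact LinearMap.congr_fun ((homDuality_bijective R S (Syz F A N)).1 comp_mkQ_eq) u
  · intro g
    obtain ⟨θ, hθ⟩ := (homDuality_bijective (F := F) R S (Syz F A N)).2 (g ∘ₗ Submodule.mkQ _)
    have comp_precomp : θ ∘ₗ precomp F (Syz F A N).subtype = 0 :=
      (homDuality_bijective R S _).1 <| LinearMap.ext fun φ => S.toDual.injective <| by
        have restrict_eq_zero : (Submodule.Quotient.mk (φ ∘ₗ (Syz F A N).subtype) :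
            ExtOne F A B N W) = 0 := (Submodule.Quotient.mk_eq_zero _).2 ⟨φ, rfl⟩
        rw [homDuality_precomp, hθ]
        refine (congrArg (fun x => S.toDual (g x)) restrict_eq_zero).trans <|
          LinearMap.ext fun m => ?_
        rw [map_zero, map_zero, homDuality_apply]
        rfl
    refine ⟨Submodule.liftQ _ θ (LinearMap.range_le_ker_iff.2 comp_precomp),
      LinearMap.ext fun x => ?_⟩
    obtain ⟨φ, rfl⟩ := Submodule.Quotient.mk_surjective _ x
    exact LinearMap.congr_fun hθ φ

theorem extDuality_comp_map (θ : Module.Dual F (ExtOne F A F N M)) (f : N →ₗ[A] N') :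
    extDuality R S (θ ∘ₗ ExtOne.map F F M f) = extDuality R S θ ∘ₗ ExtOne.map F B W f := by
  refine LinearMap.ext fun x => S.toDual.injective <| LinearMap.ext fun m => ?_
  obtain ⟨φ, rfl⟩ := Submodule.Quotient.mk_surjective _ x
  exact (extDuality_mk R S _ φ m).trans (extDuality_mk R S θ (φ ∘ₗ Syz.map F f) m).symm

theorem extDuality_comp_push (θ : Module.Dual F (ExtOne F A F N M')) (g : M →ₗ[A] M')
    (x : ExtOne F A B N W) (m : M) :
    S.toDual (extDuality R S (θ ∘ₗ ExtOne.push F g) x) m =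
      S'.toDual (extDuality R S' θ x) (g m) := by
  obtain ⟨φ, rfl⟩ := Submodule.Quotient.mk_surjective _ x
  refine (extDuality_mk R S _ φ m).trans ((congrArg (fun u => θ (Submodule.Quotient.mk u)) ?_).trans
    (extDuality_mk R S' θ φ (g m)).symm)
  exact LinearMap.ext fun p => g.map_smul _ _

end HomDuality

section ProjectiveSyzygies

variable (F : Type u) [Field F] {A : Type u} [Ring A] [Algebra F A]
variable {X X' Y Y' : Type u} [AddCommGroup X] [Module F X] [Module A X] [IsScalarTower F A X]
  [AddCommGroup X'] [Module F X'] [Module A X'] [IsScalarTower F A X']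
  [AddCommGroup Y] [Module F Y] [Module Aᵐᵒᵖ Y] [IsScalarTower F Aᵐᵒᵖ Y]
  [AddCommGroup Y'] [Module F Y'] [Module Aᵐᵒᵖ Y'] [IsScalarTower F Aᵐᵒᵖ Y']

/-- The dualities between left and right modules are adjoint on the right: maps `X → Y^*` and
`Y → X^*` are both the balanced bilinear forms on `X × Y`. -/
def flipDual : (X →ₗ[A] DualR F Y) ≃ (Y →ₗ[Aᵐᵒᵖ] DualL F X) where
  toFun f :=
    { toFun := fun y =>
        { toFun := fun x => f x y
          map_add' := fun x x' => by rw [map_add]; rfl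
          map_smul' := fun c x => by rw [LinearMap.map_smul_of_tower]; rfl }
      map_add' := fun y y' => DualL.ext F fun x => map_add (f x) y y'
      map_smul' := fun a y => DualL.ext F fun x =>
        show f x (a • y) = f (a.unop • x) y by rw [map_smul f]; rfl }
  invFun f :=
    { toFun := fun x =>
        { toFun := fun y => f y x
          map_add' := fun y y' => by rw [map_add]; rfl
          map_smul' := fun c y => by rw [LinearMap.map_smul_of_tower]; rfl }
      map_add' := fun x x' => DualR.ext F fun y => map_add (f y) x x'
      map_smul' := fun a x => DualR.ext F fun y =>
        show f y (a • x) = f (MulOpposite.op a • y) x by rw [map_smul f]; rfl }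
  left_inv _ := rfl
  right_inv _ := rfl

theorem DualL.map_surjective {i : X →ₗ[A] X'} (hi : Function.Injective i) :
    Function.Surjective (DualL.map F i) :=
  LinearMap.dualMap_surjective_of_injective (f := i.restrictScalars F) hi

theorem DualR.map_surjective {i : Y →ₗ[Aᵐᵒᵖ] Y'} (hi : Function.Injective i) :
    Function.Surjective (DualR.map F i) :=
  LinearMap.dualMap_surjective_of_injective (f := i.restrictScalars F) hi

theorem DualR.map_injective {p : Y →ₗ[Aᵐᵒᵖ] Y'} (hp : Function.Surjective p) :
    Function.Injective (DualR.map F p) :=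
  LinearMap.dualMap_injective_of_surjective (f := p.restrictScalars F) hp

theorem injective_dualR [Module.Projective Aᵐᵒᵖ Y] : Module.Injective A (DualR F Y) := by
  refine Module.Baer.injective fun I g => ?_
  obtain ⟨k, hk⟩ := Module.projective_lifting_property (DualL.map F I.subtype) (flipDual F g)
    (DualL.map_surjective F I.subtype_injective)
  refine ⟨(flipDual F).symm k, fun x hx => DualR.ext F fun y => ?_⟩
  exact DFunLike.congr_fun (LinearMap.congr_fun hk y) (⟨x, hx⟩ : I)

variable (Y) in
/-- The canonical isomorphism of a finite-dimensional right module with its double dual. -/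
def evalDualEquiv [Module.Finite F Y] : Y ≃ₗ[Aᵐᵒᵖ] DualL F (DualR F Y) :=
  LinearEquiv.ofBijective (flipDual F (A := A) LinearMap.id) (Module.evalEquiv F Y).bijective

theorem apply_evalDualEquiv_symm [Module.Finite F Y] (ξ : DualR F Y)
    (η : DualL F (DualR F Y)) : ξ ((evalDualEquiv F Y (A := A)).symm η) = η ξ :=
  DFunLike.congr_fun ((evalDualEquiv F Y (A := A)).apply_symm_apply η) ξ

theorem projective_of_injective_dualR [Module.Finite F A] [Module.Finite F Y]
    [Module.Injective A (DualR F Y)] : Module.Projective Aᵐᵒᵖ Y := by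
  have cover_surjective : Function.Surjective (cover F Aᵐᵒᵖ Y) :=
    fun y => ⟨1 ⊗ₜ y, by simp [cover]⟩
  obtain ⟨r, hr⟩ := Module.Injective.out (R := A) (DualR.map F (cover F Aᵐᵒᵖ Y))
    (DualR.map_injective F cover_surjective) LinearMap.id
  refine Module.Projective.of_split
    ((evalDualEquiv F (Aᵐᵒᵖ ⊗[F] Y) (A := A)).symm.toLinearMap ∘ₗ flipDual F r)
    (cover F Aᵐᵒᵖ Y) <| LinearMap.ext fun y => DualL.eq_of_forall_apply F fun ξ => ?_
  exact (apply_evalDualEquiv_symm F (DualR.map F (cover F Aᵐᵒᵖ Y) ξ) (flipDual F r y)).trans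
    (DFunLike.congr_fun (hr ξ) y)

theorem projective_syz (hA : IsHereditary A) (M : Type u) [AddCommGroup M] [Module F M]
    [Module A M] [IsScalarTower F A M] : Module.Projective A (Syz F A M) :=
  hA (A ⊗[F] M) inferInstance _

omit [Algebra F A] in
theorem IsHereditary.injective_of_surjective (hA : IsHereditary A) {Q Q' : Type u}
    [AddCommGroup Q] [Module A Q] [AddCommGroup Q'] [Module A Q'] [Module.Injective A Q]
    (π : Q →ₗ[A] Q') (hπ : Function.Surjective π) : Module.Injective A Q' := by
  refine Module.Baer.injective fun I g => ?_
  have : Module.Projective A I := hA A inferInstance I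
  obtain ⟨k, hk⟩ := Module.projective_lifting_property π g hπ
  obtain ⟨k', hk'⟩ := Module.Baer.of_injective (R := A) (Q := Q) ‹_› I k
  exact ⟨π ∘ₗ k', fun x hx => by rw [LinearMap.comp_apply, hk', ← LinearMap.comp_apply, hk]⟩

/-- The dual of a syzygy of right modules is a quotient of an injective left module. -/
theorem projective_syz_op [Module.Finite F A] (hA : IsHereditary A) (Y : Type u) [AddCommGroup Y]
    [Module F Y] [Module Aᵐᵒᵖ Y] [IsScalarTower F Aᵐᵒᵖ Y] [Module.Finite F Y] :
    Module.Projective Aᵐᵒᵖ (Syz F Aᵐᵒᵖ Y) := by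
  have := finite_syz F (A := Aᵐᵒᵖ) Y
  have : Module.Injective A (DualR F (Aᵐᵒᵖ ⊗[F] Y)) := injective_dualR F
  have : Module.Injective A (DualR F (Syz F Aᵐᵒᵖ Y)) := hA.injective_of_surjective
    (DualR.map F (Syz F Aᵐᵒᵖ Y).subtype)
    (DualR.map_surjective F (Submodule.subtype_injective _))
  exact projective_of_injective_dualR F (Y := Syz F Aᵐᵒᵖ Y)

end ProjectiveSyzygies

section TauAdjunction

variable (F : Type u) [Field F] (A : Type u) [Ring A] [Algebra F A]

/-- The algebra `A` as a bimodule over itself. -/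
def leftRegular : RegularBimodule A Aᵐᵒᵖ A where
  op := MulOpposite.opEquiv
  triv := LinearEquiv.refl A A
  triv_op_smul _ _ := rfl

/-- The algebra `A` as a bimodule over its opposite. -/
def rightRegular : RegularBimodule Aᵐᵒᵖ A A where
  op := MulOpposite.opEquiv.symm
  triv := { MulOpposite.opAddEquiv with map_smul' := fun _ _ => rfl }
  triv_op_smul _ _ := rfl

variable {A}

/-- The right module `M^*` as the dual of the left module `M`. -/
def dualLModule (M : Type u) [AddCommGroup M] [Module F M] [Module A M] [IsScalarTower F A M] :
    DualModule F (leftRegular A).op M (DualL F M) where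
  toDual := AddEquiv.refl (DualL F M)
  toDual_op_smul _ _ _ := rfl

/-- A finite-dimensional left module `N` as the dual of the right module `N^*`. -/
def bidualModule (N : Type u) [AddCommGroup N] [Module F N] [Module A N] [IsScalarTower F A N]
    [Module.Finite F N] : DualModule F (rightRegular A).op (DualL F N) N where
  toDual := (Module.evalEquiv F N).toAddEquiv
  toDual_op_smul _ _ _ := rfl

/-- Morphisms of `FGModuleCat A` as linear maps. -/
def fgHomEquiv (X Y : FGModuleCat.{u} A) : (X →ₗ[A] Y) ≃ (X ⟶ Y) where
  toFun := FGModuleCat.ofHom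
  invFun h := h.hom.hom
  left_inv _ := rfl
  right_inv _ := rfl

variable [Module.Finite F A]

/-- The Auslander-Reiten formula `Ext¹ (N, M)^* ≅ Hom (M, τ N)`. -/
def homTauEquiv (M N : FGModuleCat.{u} A) [Module.Projective A (Syz F A N)] :
    Module.Dual F (ExtOne F A F N M) ≃ (M ⟶ (tau F A).obj N) :=
  (Equiv.ofBijective _ (extDuality_bijective (leftRegular A) (dualLModule F M))).trans <|
    (flipDual F).symm.trans (fgHomEquiv M ((tau F A).obj N))

/-- The Auslander-Reiten formula `Ext¹ (N, M)^* ≅ Hom (τ⁻ M, N)`. -/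
def tauInvHomEquiv (M N : FGModuleCat.{u} A) [Module.Projective Aᵐᵒᵖ (Syz F Aᵐᵒᵖ (DualL F M))] :
    Module.Dual F (ExtOne F A F N M) ≃ ((tauInv F A).obj M ⟶ N) :=
  (ExtOne.transposeEquiv F A N M).symm.dualMap.toEquiv.trans <|
    (Equiv.ofBijective _ (extDuality_bijective (rightRegular A) (bidualModule F N))).trans
      (fgHomEquiv ((tauInv F A).obj M) N)

variable {M M' N N' : FGModuleCat.{u} A}

theorem homTauEquiv_comp_map [Module.Projective A (Syz F A N)] [Module.Projective A (Syz F A N')]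
    (g : N ⟶ N') (θ : Module.Dual F (ExtOne F A F N M)) :
    homTauEquiv F M N' (θ ∘ₗ ExtOne.map F F M g.hom.hom) =
      homTauEquiv F M N θ ≫ (tau F A).map g :=
  FGModuleCat.hom_ext <| (flipDual F).injective <|
    extDuality_comp_map (leftRegular A) (dualLModule F M) θ g.hom.hom

theorem homTauEquiv_comp_push [Module.Projective A (Syz F A N)]
    (f : M' ⟶ M) (θ : Module.Dual F (ExtOne F A F N M)) :
    homTauEquiv F M' N (θ ∘ₗ ExtOne.push F f.hom.hom) = f ≫ homTauEquiv F M N θ :=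
  FGModuleCat.hom_ext <| LinearMap.ext fun m => DualR.ext F fun x =>
    extDuality_comp_push (leftRegular A) (dualLModule F M') (dualLModule F M) θ f.hom.hom x m

section

variable [Module.Projective Aᵐᵒᵖ (Syz F Aᵐᵒᵖ (DualL F M))]

theorem tauInvHomEquiv_comp_map (g : N ⟶ N') (θ : Module.Dual F (ExtOne F A F N M)) :
    tauInvHomEquiv F M N' (θ ∘ₗ ExtOne.map F F M g.hom.hom) = tauInvHomEquiv F M N θ ≫ g := by
  have transpose_symm : (θ ∘ₗ ExtOne.map F F M g.hom.hom) ∘ₗ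
        (ExtOne.transposeEquiv F A N' M).symm.toLinearMap =
      (θ ∘ₗ (ExtOne.transposeEquiv F A N M).symm.toLinearMap) ∘ₗ
        ExtOne.push F (DualL.map F g.hom.hom) :=
    LinearMap.ext fun y => congrArg θ <| (LinearEquiv.eq_symm_apply _).2 <| by
      rw [LinearEquiv.coe_coe, ExtOne.transposeEquiv_map, LinearEquiv.apply_symm_apply]
  refine FGModuleCat.hom_ext <| LinearMap.ext fun x => DualL.eq_of_forall_apply F fun ξ => ?_
  refine (congrArg (fun η => ξ (extDuality (rightRegular A) (bidualModule F N') η x))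
    transpose_symm).trans ?_
  exact extDuality_comp_push (rightRegular A) (bidualModule F N') (bidualModule F N) _
    (DualL.map F g.hom.hom) x ξ

theorem tauInvHomEquiv_comp_push [Module.Projective Aᵐᵒᵖ (Syz F Aᵐᵒᵖ (DualL F M'))] (f : M' ⟶ M)
    (θ : Module.Dual F (ExtOne F A F N M)) :
    tauInvHomEquiv F M' N (θ ∘ₗ ExtOne.push F f.hom.hom) =
      (tauInv F A).map f ≫ tauInvHomEquiv F M N θ := by
  have transpose_symm : (θ ∘ₗ ExtOne.push F f.hom.hom) ∘ₗ
        (ExtOne.transposeEquiv F A N M').symm.toLinearMap =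
      (θ ∘ₗ (ExtOne.transposeEquiv F A N M).symm.toLinearMap) ∘ₗ
        ExtOne.map F F (DualL F N) (DualL.map F f.hom.hom) :=
    LinearMap.ext fun y => congrArg θ <| (LinearEquiv.eq_symm_apply _).2 <| by
      rw [LinearEquiv.coe_coe, ExtOne.transposeEquiv_push, LinearEquiv.apply_symm_apply]
  refine FGModuleCat.hom_ext <| (congrArg (extDuality (rightRegular A) (bidualModule F N))
    transpose_symm).trans ?_
  exact extDuality_comp_map (rightRegular A) (bidualModule F N) _ (DualL.map F f.hom.hom)

end

/-- For a hereditary algebra `τ⁻` is left adjoint to `τ`, because both `Hom (τ⁻ M, N)` and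
`Hom (M, τ N)` are the dual of `Ext¹ (N, M)`. -/
def tauAdjunction (hA : IsHereditary A) : tauInv F A ⊣ tau F A :=
  have := projective_syz F hA
  have := projective_syz_op F hA
  Adjunction.mkOfHomEquiv
    { homEquiv := fun M N => (tauInvHomEquiv F M N).symm.trans (homTauEquiv F M N)
      homEquiv_naturality_left_symm := fun {M' M N} f g => by
        obtain ⟨θ, rfl⟩ := (homTauEquiv F M N).surjective g
        rw [← homTauEquiv_comp_push]
        simp only [Equiv.symm_trans_apply, Equiv.symm_symm, Equiv.symm_apply_apply]
        exact tauInvHomEquiv_comp_push F f θ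
      homEquiv_naturality_right := fun {M N N'} f g => by
        obtain ⟨θ, rfl⟩ := (tauInvHomEquiv F M N).surjective f
        rw [← tauInvHomEquiv_comp_map]
        simp only [Equiv.trans_apply, Equiv.symm_apply_apply]
        exact homTauEquiv_comp_map F g θ }

end TauAdjunction

end

end HereditaryAlgebra

theorem proposition3p3 {F Λ : Type u} [Field F] [Ring Λ] [Algebra F Λ] [Module.Finite F Λ]
    (hΛ : HereditaryAlgebra.IsHereditary Λ) :
    -- the functor `τ⁻` is left adjoint to `τ`
    Nonempty (HereditaryAlgebra.tauInv F Λ ⊣ HereditaryAlgebra.tau F Λ) ∧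
    -- and, whichever adjunction is used to define `Δ`, the map `Δ` is
    ∀ adj : HereditaryAlgebra.tauInv F Λ ⊣ HereditaryAlgebra.tau F Λ,
      -- an isomorphism of algebras
      (∃ e : HereditaryAlgebra.Preprojective F Λ ≃ₐ[F] HereditaryAlgebra.Postinjective F Λ,
        ∀ x, e x = HereditaryAlgebra.Delta F adj x) ∧
      -- which respects the gradings
      (∀ r : ℕ, (HereditaryAlgebra.Preprojective.degree F Λ r).map
          (HereditaryAlgebra.Delta F adj) = HereditaryAlgebra.Postinjective.degree F Λ r) ∧
      -- and is given on each component `Hom (P, τ^{-r} Q)` by the chain of isomorphisms `delta`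
      ∀ (P Q : FGModuleCat.{u} Λ) [Module.Projective Λ P] [Module.Projective Λ Q] (r : ℕ)
        (a : HereditaryAlgebra.regular Λ ⟶ P) (b : Q ⟶ HereditaryAlgebra.regular Λ)
        (f : P ⟶ (HereditaryAlgebra.iterL (HereditaryAlgebra.tauInv F Λ) r).obj Q),
        HereditaryAlgebra.Delta F adj (HereditaryAlgebra.Preprojective.of F Λ r
            (a ≫ f ≫ (HereditaryAlgebra.iterL (HereditaryAlgebra.tauInv F Λ) r).map b)) =
          HereditaryAlgebra.Postinjective.of F Λ r
            ((HereditaryAlgebra.iterR (HereditaryAlgebra.tau F Λ) r).map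
                ((HereditaryAlgebra.nuRegular F Λ).inv ≫ (HereditaryAlgebra.nu F Λ).map a) ≫
              HereditaryAlgebra.delta F adj P Q r f ≫
              (HereditaryAlgebra.nu F Λ).map b ≫ (HereditaryAlgebra.nuRegular F Λ).hom) :=
  ⟨⟨HereditaryAlgebra.tauAdjunction F hΛ⟩, fun adj =>
    HereditaryAlgebra.proposition3p3_general adj (HereditaryAlgebra.nuRegular F Λ)⟩
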